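/- All objects are smooth ($C^\infty$), and manifolds are finite-dimensional, Hausdorff and without boundary. We use the conventions $d\alpha(X,Y)=X(\alpha(Y))-Y(\alpha(X))-\alpha([X,Y])$ and $(\alpha\wedge\beta)(X,Y)=\alpha(X)\beta(Y)-\alpha(Y)\beta(X)$ for $1$-forms. **Definitions.** Let $h,k\ge 0$. A pair $(\alpha_1,\alpha_2)$ of $1$-forms on a manifold $M$ is a *contact pair of type $(h,k)$* if $\alpha_1\wedge(d\alpha_1)^h\wedge\alpha_2\wedge(d\alpha_2)^k$ is a volume form (in particular $\dim M=2h+2k+2$), $(d\alpha_1)^{h+1}=0$ and $(d\alpha_2)^{k+1}=0$. Its *Reeb vector fields* $Z_1,Z_2$ are the vector fields determined by $\alpha_i(Z_j)=\delta_{ij}$ and $i_{Z_j}d\alpha_i=0$ for $i,j=1,2$. They commute and generate a locally free (local, if the fields are not complete) action of $\mathbb R^2$ on $M$, the *Reeb action*; the orbit of $p$ consists of all points that can be reached from $p$ by finitely many arcs of integral curves of $Z_1$ and $Z_2$. A *contact pair structure* on $M$ is a triple $(\alpha_1,\alpha_2,\varphi)$, where $(\alpha_1,\alpha_2)$ is a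 contact pair and $\varphi$ is a field of endomorphisms of $TM$ with $\varphi^2=-\mathrm{Id}+\alpha_1\otimes Z_1+\alpha_2\otimes Z_2$ and $\varphi(Z_1)=\varphi(Z_2)=0$. A Riemannian metric $g$ on $M$ is - *compatible* if $g(\varphi X,\varphi Y)=g(X,Y)-\alpha_1(X)\alpha_1(Y)-\alpha_2(X)\alpha_2(Y)$ for all $X,Y$; - *associated* if $g(X,\varphi Y)=(d\alpha_1+d\alpha_2)(X,Y)$ and $g(X,Z_i)=\alpha_i(X)$ for all $X,Y$ and $i=1,2$. **Theorem.** Let $M$ be a manifold with a contact pair structure $(\alpha_1,\alpha_2,\varphi)$ with Reeb vector fields $Z_1,Z_2$, and let $g$ be a compatible metric with Levi-Civita connection $\nabla$. Then: 1. $g(Z_i,X)=\alpha_i(X)$ for $i=1,2$ and every vector field $X$; 2. $g(Z_i,Z_j)=\delta_{ij}$ for $i,j=1,2$; 3. $\nabla_{Z_i}Z_j=0$ for $i,j=1,2$; in particular the integral curves of $Z_1$ and of $Z_2$ are geodesics; 4. the Reeb action is totally geodesic: every orbit is a totally geodesic (injectively immersed) $2$-dimensional submanifold of $M$, i.e. its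 second fundamental form vanishes. Moreover, if $g$ is an associated metric, then for each $i\in\{1,2\}$ one has $L_{Z_i}\varphi=0$ if and only if $Z_i$ is a Killing vector field, i.e. $L_{Z_i}g=0$. -/

import Mathlib

open Bundle Set
open scoped Manifold ContDiff Topology

noncomputable section

namespace ContactPair

universe u v

/-! ### Multilinear algebra: wedge products of real alternating forms -/

section Algebra

variable {V : Type*} [AddCommGroup V] [Module ℝ V]

/-- The exterior product of alternating forms, in the convention without factorials
(a sum over shuffles, so `(a ∧ b) (u, w) = a u * b w - a w * b u` for `1`-forms). -/
def wedge {m n : ℕ} (a : V [⋀^Fin m]→ₗ[ℝ] ℝ) (b : V [⋀^Fin n]→ₗ[ℝ] ℝ) :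
    V [⋀^Fin (m + n)]→ₗ[ℝ] ℝ :=
  ((LinearMap.mul' ℝ ℝ).compAlternatingMap (a.domCoprod b)).domDomCongr finSumFinEquiv

/-- The `k`-th exterior power `a ∧ ⋯ ∧ a` of a `2`-form. -/
def wedgePow (a : V [⋀^Fin 2]→ₗ[ℝ] ℝ) : (k : ℕ) → V [⋀^Fin (2 * k)]→ₗ[ℝ] ℝ
  | 0 => AlternatingMap.constOfIsEmpty ℝ V (Fin 0) (1 : ℝ)
  | k + 1 => wedge (wedgePow a k) a

end Algebra

variable {E : Type v} [NormedAddCommGroup E] [NormedSpace ℝ E]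
  {M : Type u} [TopologicalSpace M] [ChartedSpace E M]

/-! ### Tensor fields on a manifold without boundary modelled on `E` -/

/-- Smoothness of a vector field. -/
def SmoothField [IsManifold 𝓘(ℝ, E) ∞ M] (X : Π x : M, TangentSpace 𝓘(ℝ, E) x) : Prop :=
  ContMDiff 𝓘(ℝ, E) (𝓘(ℝ, E).prod 𝓘(ℝ, E)) ∞
    (fun x ↦ (TotalSpace.mk' E x (X x) : TangentBundle 𝓘(ℝ, E) M))

/-- Smoothness of a `1`-form, as a section of the cotangent bundle. -/
def SmoothOneForm [IsManifold 𝓘(ℝ, E) ∞ M] (α : Π x : M, TangentSpace 𝓘(ℝ, E) x →L[ℝ] ℝ) :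
    Prop :=
  ContMDiff 𝓘(ℝ, E) (𝓘(ℝ, E).prod 𝓘(ℝ, E →L[ℝ] ℝ)) ∞
    (fun x ↦ TotalSpace.mk' (E →L[ℝ] ℝ)
      (E := fun x : M ↦ TangentSpace 𝓘(ℝ, E) x →L[ℝ] ℝ) x (α x))

/-- Smoothness of a `(1,1)`-tensor, as a section of the endomorphism bundle of `TM`. -/
def SmoothEndo [IsManifold 𝓘(ℝ, E) ∞ M]
    (φ : Π x : M, TangentSpace 𝓘(ℝ, E) x →L[ℝ] TangentSpace 𝓘(ℝ, E) x) : Prop :=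
  ContMDiff 𝓘(ℝ, E) (𝓘(ℝ, E).prod 𝓘(ℝ, E →L[ℝ] E)) ∞
    (fun x ↦ TotalSpace.mk' (E →L[ℝ] E)
      (E := fun x : M ↦ TangentSpace 𝓘(ℝ, E) x →L[ℝ] TangentSpace 𝓘(ℝ, E) x) x (φ x))

/-- The exterior derivative of a `1`-form at `x`: read the form in the preferred chart at `x`,
differentiate there, and pull the result back to `T_x M`. The normalization is
`dα(X, Y) = X (α Y) - Y (α X) - α [X, Y]`. -/
def extDerivOne (α : Π x : M, TangentSpace 𝓘(ℝ, E) x →L[ℝ] ℝ) (x : M) :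
    TangentSpace 𝓘(ℝ, E) x [⋀^Fin 2]→L[ℝ] ℝ :=
  (extDeriv (fun y : E ↦ ContinuousAlternatingMap.ofSubsingleton ℝ E ℝ (0 : Fin 1)
      ((α ((extChartAt 𝓘(ℝ, E) x).symm y)).comp
        (mfderiv 𝓘(ℝ, E) 𝓘(ℝ, E) (extChartAt 𝓘(ℝ, E) x).symm y)))
    (extChartAt 𝓘(ℝ, E) x x)).compContinuousLinearMap
      (mfderiv 𝓘(ℝ, E) 𝓘(ℝ, E) (extChartAt 𝓘(ℝ, E) x) x)

/-! ### Contact pairs and contact pair structures -/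

/-- The form `α₁ ∧ (dα₁)^h ∧ α₂ ∧ (dα₂)^k` at the point `x`. -/
def contactVolume (h k : ℕ) (α₁ α₂ : Π x : M, TangentSpace 𝓘(ℝ, E) x →L[ℝ] ℝ) (x : M) :
    TangentSpace 𝓘(ℝ, E) x [⋀^Fin (1 + 2 * h + 1 + 2 * k)]→ₗ[ℝ] ℝ :=
  wedge
    (wedge
      (wedge
        (AlternatingMap.ofSubsingleton ℝ (TangentSpace 𝓘(ℝ, E) x) ℝ (0 : Fin 1)
          (α₁ x : TangentSpace 𝓘(ℝ, E) x →ₗ[ℝ] ℝ))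
        (wedgePow (extDerivOne α₁ x).toAlternatingMap h))
      (AlternatingMap.ofSubsingleton ℝ (TangentSpace 𝓘(ℝ, E) x) ℝ (0 : Fin 1)
        (α₂ x : TangentSpace 𝓘(ℝ, E) x →ₗ[ℝ] ℝ)))
    (wedgePow (extDerivOne α₂ x).toAlternatingMap k)

/-- `(α₁, α₂)` is a contact pair of type `(h, k)`. A volume form is a nowhere vanishing form of
top degree, whence the condition on the dimension. -/
structure IsContactPair [IsManifold 𝓘(ℝ, E) ∞ M] (h k : ℕ)
    (α₁ α₂ : Π x : M, TangentSpace 𝓘(ℝ, E) x →L[ℝ] ℝ) : Prop where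
  smooth₁ : SmoothOneForm α₁
  smooth₂ : SmoothOneForm α₂
  top_degree : Module.finrank ℝ E = 1 + 2 * h + 1 + 2 * k
  volume_ne_zero : ∀ x : M, contactVolume h k α₁ α₂ x ≠ 0
  pow_eq_zero₁ : ∀ x : M, wedgePow (extDerivOne α₁ x).toAlternatingMap (h + 1) = 0
  pow_eq_zero₂ : ∀ x : M, wedgePow (extDerivOne α₂ x).toAlternatingMap (k + 1) = 0

/-- `Z 0`, `Z 1` are the Reeb vector fields of the pair `α 0`, `α 1`:
`α_i (Z_j) = δ_ij` and `i_{Z_j} dα_i = 0`. -/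
structure IsReebPair [IsManifold 𝓘(ℝ, E) ∞ M]
    (α : Fin 2 → Π x : M, TangentSpace 𝓘(ℝ, E) x →L[ℝ] ℝ)
    (Z : Fin 2 → Π x : M, TangentSpace 𝓘(ℝ, E) x) : Prop where
  smooth : ∀ i, SmoothField (Z i)
  apply_eq : ∀ i j (x : M), α i x (Z j x) = if i = j then 1 else 0
  contract_eq_zero : ∀ i j (x : M) (w : TangentSpace 𝓘(ℝ, E) x),
    extDerivOne (α i) x ![Z j x, w] = 0

/-- `(α 0, α 1, φ)` is a contact pair structure of type `(h, k)` with Reeb vector fields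
`Z 0`, `Z 1`. -/
structure IsContactPairStructure [IsManifold 𝓘(ℝ, E) ∞ M] (h k : ℕ)
    (α : Fin 2 → Π x : M, TangentSpace 𝓘(ℝ, E) x →L[ℝ] ℝ)
    (Z : Fin 2 → Π x : M, TangentSpace 𝓘(ℝ, E) x)
    (φ : Π x : M, TangentSpace 𝓘(ℝ, E) x →L[ℝ] TangentSpace 𝓘(ℝ, E) x) : Prop where
  contactPair : IsContactPair h k (α 0) (α 1)
  reeb : IsReebPair α Z
  smooth : SmoothEndo φ
  sq_eq : ∀ (x : M) (w : TangentSpace 𝓘(ℝ, E) x),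
    φ x (φ x w) = -w + α 0 x w • Z 0 x + α 1 x w • Z 1 x
  map_reeb : ∀ i (x : M), φ x (Z i x) = 0

/-! ### Metrics -/

/-- Smooth Riemannian metrics on `M`. -/
abbrev Metric (E : Type v) [NormedAddCommGroup E] [NormedSpace ℝ E]
    (M : Type u) [TopologicalSpace M] [ChartedSpace E M] [IsManifold 𝓘(ℝ, E) ∞ M] :=
  ContMDiffRiemannianMetric 𝓘(ℝ, E) ∞ E (TangentSpace 𝓘(ℝ, E) : M → Type v)

/-- `g(φX, φY) = g(X, Y) - α₁(X) α₁(Y) - α₂(X) α₂(Y)`. -/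
def IsCompatible [IsManifold 𝓘(ℝ, E) ∞ M]
    (α : Fin 2 → Π x : M, TangentSpace 𝓘(ℝ, E) x →L[ℝ] ℝ)
    (φ : Π x : M, TangentSpace 𝓘(ℝ, E) x →L[ℝ] TangentSpace 𝓘(ℝ, E) x)
    (g : Metric E M) : Prop :=
  ∀ (x : M) (u w : TangentSpace 𝓘(ℝ, E) x),
    g.inner x (φ x u) (φ x w) =
      g.inner x u w - α 0 x u * α 0 x w - α 1 x u * α 1 x w

/-- `g(X, φY) = (dα₁ + dα₂)(X, Y)` and `g(X, Z_i) = α_i(X)`. -/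
def IsAssociated [IsManifold 𝓘(ℝ, E) ∞ M]
    (α : Fin 2 → Π x : M, TangentSpace 𝓘(ℝ, E) x →L[ℝ] ℝ)
    (Z : Fin 2 → Π x : M, TangentSpace 𝓘(ℝ, E) x)
    (φ : Π x : M, TangentSpace 𝓘(ℝ, E) x →L[ℝ] TangentSpace 𝓘(ℝ, E) x)
    (g : Metric E M) : Prop :=
  (∀ (x : M) (u w : TangentSpace 𝓘(ℝ, E) x),
    g.inner x u (φ x w) = (extDerivOne (α 0) x + extDerivOne (α 1) x) ![u, w]) ∧
  ∀ i (x : M) (u : TangentSpace 𝓘(ℝ, E) x), g.inner x u (Z i x) = α i x u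

/-! ### Levi-Civita connection, geodesics, totally geodesic surfaces -/

/-- Affine connections on `M`; `cov Y x u` is `∇_u Y` for `u ∈ T_x M`. -/
abbrev Connection (E : Type v) [NormedAddCommGroup E] [NormedSpace ℝ E]
    (M : Type u) [TopologicalSpace M] [ChartedSpace E M] [IsManifold 𝓘(ℝ, E) ∞ M] :=
  CovariantDerivative 𝓘(ℝ, E) E (TangentSpace 𝓘(ℝ, E) : M → Type v)

/-- `cov` is the Levi-Civita connection of `g`: it is torsion free, and
`u (g(Y, W)) = g(∇_u Y, W) + g(Y, ∇_u W)`. -/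
structure IsLeviCivita [FiniteDimensional ℝ E] [IsManifold 𝓘(ℝ, E) ∞ M]
    (g : Metric E M) (cov : Connection E M) : Prop where
  torsion_eq_zero : cov.torsion = 0
  metric : ∀ (x : M) (Y W : Π x : M, TangentSpace 𝓘(ℝ, E) x),
    MDifferentiableAt 𝓘(ℝ, E) (𝓘(ℝ, E).prod 𝓘(ℝ, E))
      (fun x ↦ (TotalSpace.mk' E x (Y x) : TangentBundle 𝓘(ℝ, E) M)) x →
    MDifferentiableAt 𝓘(ℝ, E) (𝓘(ℝ, E).prod 𝓘(ℝ, E))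
      (fun x ↦ (TotalSpace.mk' E x (W x) : TangentBundle 𝓘(ℝ, E) M)) x →
    ∀ u : TangentSpace 𝓘(ℝ, E) x,
      mvfderiv 𝓘(ℝ, E) (fun y : M ↦ g.inner y (Y y) (W y)) x u =
        g.inner x (cov Y x u) (W x) + g.inner x (Y x) (cov W x u)

/-- The velocity of a curve. -/
def velocity (γ : ℝ → M) (t : ℝ) : TangentSpace 𝓘(ℝ, E) (γ t) :=
  mfderiv 𝓘(ℝ, ℝ) 𝓘(ℝ, E) γ t (1 : ℝ)

/-- The vector field around `x` which has constant components in the preferred chart at `x`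
and takes the value `w` at `x`. -/
def coordField (x : M) (w : TangentSpace 𝓘(ℝ, E) x) : Π y : M, TangentSpace 𝓘(ℝ, E) y :=
  VectorField.mpullback 𝓘(ℝ, E) 𝓘(ℝ, E) (extChartAt 𝓘(ℝ, E) x)
    (fun _ : E ↦ mfderiv 𝓘(ℝ, E) 𝓘(ℝ, E) (extChartAt 𝓘(ℝ, E) x) x w)

/-- The covariant derivative at time `t` of a vector field `V` along a curve `γ`: in the
preferred chart at `γ t` it is `dV^k/dt ∂_k + V^j ∇_{γ'} ∂_j`, the usual coordinate formula. -/
def covDerivAlong [IsManifold 𝓘(ℝ, E) ∞ M] (cov : Connection E M) (γ : ℝ → M)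
    (V : Π t : ℝ, TangentSpace 𝓘(ℝ, E) (γ t)) (t : ℝ) : TangentSpace 𝓘(ℝ, E) (γ t) :=
  (mfderiv 𝓘(ℝ, E) 𝓘(ℝ, E) (extChartAt 𝓘(ℝ, E) (γ t)) (γ t)).inverse
      (deriv (fun s : ℝ ↦
        (mfderiv 𝓘(ℝ, E) 𝓘(ℝ, E) (extChartAt 𝓘(ℝ, E) (γ t)) (γ s) (V s) : E)) t) +
    cov (coordField (γ t) (V t)) (γ t) (velocity γ t)

/-- `γ` restricted to the open set of times `s` is a geodesic: it is smooth and the covariant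
derivative of its velocity along itself vanishes. -/
def IsGeodesicOn [IsManifold 𝓘(ℝ, E) ∞ M] (cov : Connection E M) (γ : ℝ → M) (s : Set ℝ) :
    Prop :=
  ContMDiffOn 𝓘(ℝ, ℝ) 𝓘(ℝ, E) ∞ γ s ∧ ∀ t ∈ s, covDerivAlong cov γ (velocity γ) t = 0

/-- The second fundamental form of the immersion `f` (with respect to `cov`) vanishes: for every
vector field `Y` on `M`, differentiable at `f q` and tangent to `f` along a neighbourhood of `q`,
the derivatives `∇_u Y` in directions `u` tangent to `f` at `q` are again tangent to `f`. -/
def IsTotallyGeodesic [IsManifold 𝓘(ℝ, E) ∞ M] (cov : Connection E M)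
    {N : Type u} [TopologicalSpace N] [ChartedSpace (EuclideanSpace ℝ (Fin 2)) N] (f : N → M) :
    Prop :=
  ∀ (q : N) (Y : Π x : M, TangentSpace 𝓘(ℝ, E) x),
    MDifferentiableAt 𝓘(ℝ, E) (𝓘(ℝ, E).prod 𝓘(ℝ, E))
      (fun x ↦ (TotalSpace.mk' E x (Y x) : TangentBundle 𝓘(ℝ, E) M)) (f q) →
    (∀ᶠ q' in 𝓝 q, Y (f q') ∈ range (mfderiv (𝓡 2) 𝓘(ℝ, E) f q')) →
    ∀ w : TangentSpace (𝓡 2) q,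
      cov Y (f q) (mfderiv (𝓡 2) 𝓘(ℝ, E) f q w) ∈ range (mfderiv (𝓡 2) 𝓘(ℝ, E) f q)

/-- The subset `S` of `M` is a totally geodesic (immersed) surface: it is the image of a smooth
`2`-dimensional manifold under an injective totally geodesic immersion. -/
def IsTotallyGeodesicSurface [IsManifold 𝓘(ℝ, E) ∞ M] (cov : Connection E M) (S : Set M) :
    Prop :=
  ∃ (N : Type u) (_ : TopologicalSpace N) (_ : ChartedSpace (EuclideanSpace ℝ (Fin 2)) N)
    (_ : IsManifold (𝓡 2) ∞ N) (_ : T2Space N) (f : N → M),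
    ContMDiff (𝓡 2) 𝓘(ℝ, E) ∞ f ∧
    (∀ q : N, Function.Injective (mfderiv (𝓡 2) 𝓘(ℝ, E) f q)) ∧
    Function.Injective f ∧ range f = S ∧ IsTotallyGeodesic cov f

/-! ### The Reeb action -/

/-- `x` and `y` lie on one integral curve of `Z 0` or of `Z 1`. -/
def FlowRel (Z : Fin 2 → Π x : M, TangentSpace 𝓘(ℝ, E) x) (x y : M) : Prop :=
  ∃ (i : Fin 2) (γ : ℝ → M) (s : Set ℝ), IsOpen s ∧ s.OrdConnected ∧
    IsMIntegralCurveOn γ (Z i) s ∧ ∃ t₀ ∈ s, ∃ t₁ ∈ s, γ t₀ = x ∧ γ t₁ = y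

/-- The orbit of `p` under the action of `ℝ²` (a local action, if the vector fields are not
complete) which is generated by the flows of `Z 0` and `Z 1`. -/
def reebOrbit (Z : Fin 2 → Π x : M, TangentSpace 𝓘(ℝ, E) x) (p : M) : Set M :=
  {q | Relation.ReflTransGen (FlowRel Z) p q}

/-! ### Lie derivatives -/

/-- `(L_Z g)(X, Y) = Z (g(X, Y)) - g([Z, X], Y) - g(X, [Z, Y])`. -/
def lieDerivMetric [IsManifold 𝓘(ℝ, E) ∞ M] (g : Metric E M)
    (Z X Y : Π x : M, TangentSpace 𝓘(ℝ, E) x) (x : M) : ℝ :=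
  mvfderiv 𝓘(ℝ, E) (fun y : M ↦ g.inner y (X y) (Y y)) x (Z x)
    - g.inner x (VectorField.mlieBracket 𝓘(ℝ, E) Z X x) (Y x)
    - g.inner x (X x) (VectorField.mlieBracket 𝓘(ℝ, E) Z Y x)

/-- `Z` is a Killing vector field of `g`: `L_Z g = 0`. -/
def IsKilling [IsManifold 𝓘(ℝ, E) ∞ M] (g : Metric E M)
    (Z : Π x : M, TangentSpace 𝓘(ℝ, E) x) : Prop :=
  ∀ X Y : Π x : M, TangentSpace 𝓘(ℝ, E) x, SmoothField X → SmoothField Y →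
    ∀ x : M, lieDerivMetric g Z X Y x = 0

/-- `(L_Z φ)(Y) = [Z, φ Y] - φ [Z, Y]`. -/
def lieDerivEndo (Z : Π x : M, TangentSpace 𝓘(ℝ, E) x)
    (φ : Π x : M, TangentSpace 𝓘(ℝ, E) x →L[ℝ] TangentSpace 𝓘(ℝ, E) x)
    (Y : Π x : M, TangentSpace 𝓘(ℝ, E) x) (x : M) : TangentSpace 𝓘(ℝ, E) x :=
  VectorField.mlieBracket 𝓘(ℝ, E) Z (fun y ↦ φ y (Y y)) x
    - φ x (VectorField.mlieBracket 𝓘(ℝ, E) Z Y x)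

/-- `L_Z φ = 0`. -/
def LieDerivEndoVanishes [IsManifold 𝓘(ℝ, E) ∞ M] (Z : Π x : M, TangentSpace 𝓘(ℝ, E) x)
    (φ : Π x : M, TangentSpace 𝓘(ℝ, E) x →L[ℝ] TangentSpace 𝓘(ℝ, E) x) : Prop :=
  ∀ Y : Π x : M, TangentSpace 𝓘(ℝ, E) x, SmoothField Y → ∀ x : M, lieDerivEndo Z φ Y x = 0

end ContactPair

end

noncomputable section

namespace ContactPair

/-! ### Total differential equations with commuting coefficients -/

section TotalDifferential

open Metric
open scoped NNReal

/-! Since the contact volume form vanishes nowhere, a tangent vector killed by both `α i` and by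
both contractions with `dα_i` is zero (`IsContactPair.eq_zero`). Cartan's formula gives `L_{Z_j} α_i
= 0` and `L_{Z_j} dα_i = 0`, so `[Z_i, Z_j]` is such a vector and the Reeb fields commute.

Putting `X = Z_i` into compatibility gives `g(Z_i, ·) = α_i`. With `L_{Z_i} α_j = 0` and zero
torsion, `g(∇_{Z_i} Z_j, X) = -g(Z_j, ∇_X Z_i)`. The left side is symmetric in `i, j` because the
fields commute, so adding the two versions yields `-X(g(Z_i, Z_j)) = 0`. Hence `∇_{Z_i} Z_j = 0`,
and integral curves are geodesics.

An orbit gets its surface structure from local orbit maps `G` with `dG(v) = v₀ Z₀ + v₁ Z₁`. In a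
chart this is a total differential equation, integrable because the fields commute
(`exists_hasFDerivAt_of_commute`). Uniqueness makes the changes of charts local translations. If `Y`
is tangent along the orbit, then `Y - Σ α_i(Y) Z_i` vanishes there and has zero derivative in orbit
directions; the remaining part has derivative `Σ u(α_i(Y)) Z_i`, which is tangent.

For an associated metric, `g(A, φ B) = (dα_0 + dα_1)(A, B)` is invariant under `Z_i`, so `(L g)(A, φ
B) + g(A, (L φ) B) = 0`. This identity links the two vanishing conditions. -/

theorem exists_hasDerivWithinAt_Icc_mem_closedBall {E : Type*} [NormedAddCommGroup E]
    [NormedSpace ℝ E] [CompleteSpace E] {f : E → E} {x₀ : E} {a L K : ℝ≥0} (hLa : L ≤ a)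
    (hb : ∀ x ∈ closedBall x₀ a, ‖f x‖ ≤ L) (hl : LipschitzOnWith K f (closedBall x₀ a)) :
    ∃ y : ℝ → E, y 0 = x₀ ∧ (∀ t ∈ Icc (0 : ℝ) 1, y t ∈ closedBall x₀ a) ∧
      ∀ t ∈ Icc (0 : ℝ) 1, HasDerivWithinAt y (f (y t)) (Icc 0 1) t := by
  have hf : IsPicardLindelof (fun _ ↦ f) (tmin := 0) (tmax := 1) ⟨0, by simp⟩ x₀ a 0 L K := by
    apply IsPicardLindelof.of_time_independent hb hl
    simpa using hLa
  -- The fixed point of the Picard operator also records that the curve stays in the closed ball;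
  -- speed at most `L ≤ a` over unit time cannot leave it.
  obtain ⟨β, hβ⟩ := ODE.FunSpace.exists_isFixedPt_next hf (mem_closedBall_self le_rfl)
  refine ⟨β.compProj, ?_, fun t _ ↦ β.compProj_mem_closedBall hf.mul_max_le, fun t ht ↦ ?_⟩
  · rw [ODE.FunSpace.compProj_of_mem (by simp), ← hβ, ODE.FunSpace.next_apply₀]
  apply ODE.hasDerivWithinAt_picard_Icc (t₀ := 0) (u := closedBall x₀ a) (by simp)
    hf.continuousOn_uncurry β.continuous_compProj.continuousOn
    (fun _ _ ↦ β.compProj_mem_closedBall hf.mul_max_le) x₀ ht |>.congr_of_mem _ ht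
  intro t' ht'
  nth_rw 1 [← hβ]
  rw [ODE.FunSpace.compProj_of_mem ht', ODE.FunSpace.next_apply]

variable {P E : Type*} [NormedAddCommGroup P] [NormedSpace ℝ P]
  [NormedAddCommGroup E] [NormedSpace ℝ E]

/-- Second order Taylor estimate for a map with Lipschitz derivative. -/
theorem norm_sub_sub_fderiv_le {F G : Type*} [NormedAddCommGroup F] [NormedSpace ℝ F]
    [NormedAddCommGroup G] [NormedSpace ℝ G] {A : F → G} {s : Set F} (hs : Convex ℝ s)
    (hso : IsOpen s) (hA : DifferentiableOn ℝ A s) {K : ℝ≥0}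
    (hK : LipschitzOnWith K (fderiv ℝ A) s) {x y : F} (hx : x ∈ s) (hy : y ∈ s) :
    ‖A y - A x - fderiv ℝ A x (y - x)‖ ≤ K * ‖y - x‖ ^ 2 := by
  -- Mean value inequality on the segment, where the derivative differs from its value at `x` by at
  -- most `K * ‖y - x‖`.
  have h := Convex.norm_image_sub_le_of_norm_hasFDerivWithin_le' (𝕜 := ℝ) (f := A)
    (f' := fderiv ℝ A) (φ := fderiv ℝ A x) (s := segment ℝ x y) (C := K * ‖y - x‖)
    (fun z hz ↦ ((hA z (hs.segment_subset hx hy hz)).differentiableAt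
      (hso.mem_nhds (hs.segment_subset hx hy hz))).hasFDerivAt.hasFDerivWithinAt)
    (fun z hz ↦ ?_) (convex_segment x y) (left_mem_segment ℝ x y) (right_mem_segment ℝ x y)
  · rwa [pow_two, ← mul_assoc]
  · refine (hK.norm_sub_le (hs.segment_subset hx hy hz) hx).trans ?_
    gcongr
    obtain ⟨a, b, ha, hb, hab, rfl⟩ := hz
    obtain rfl : a = 1 - b := by linarith
    have : (1 - b) • x + b • y - x = b • (y - x) := by module
    rw [this, norm_smul, Real.norm_of_nonneg hb]
    exact mul_le_of_le_one_left (norm_nonneg _) (by linarith)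

/-- A total differential equation `dF = A(F)` whose coefficients commute is solvable. -/
theorem exists_hasFDerivAt_of_commute [CompleteSpace E] {A : E → P →L[ℝ] E} {U : Set E}
    (hU : IsOpen U) (hA : ContDiffOn ℝ 2 A U)
    (hcomm : ∀ x ∈ U, ∀ v w, fderiv ℝ A x (A x v) w = fderiv ℝ A x (A x w) v)
    {x₀ : E} (hx₀ : x₀ ∈ U) :
    ∃ r > 0, ∃ F : P → E, F 0 = x₀ ∧
      ∀ v ∈ ball (0 : P) r, F v ∈ U ∧ HasFDerivAt F (A (F v)) v := by
  have hA₀ : ContDiffAt ℝ 2 A x₀ := hA.contDiffAt (hU.mem_nhds hx₀)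
  obtain ⟨K₁, s₁, hs₁, hK₁⟩ := (hA₀.of_le one_le_two).exists_lipschitzOnWith
  obtain ⟨K₂, s₂, hs₂, hK₂⟩ :=
    (hA₀.fderiv_right (m := 1) (by norm_num [one_add_one_eq_two])).exists_lipschitzOnWith
  obtain ⟨R, hR, hRs⟩ := Metric.mem_nhds_iff.1
    (Filter.inter_mem (Filter.inter_mem hs₁ hs₂) (hU.mem_nhds hx₀))
  set B := ball x₀ R with hB
  have hBU : B ⊆ U := fun x hx ↦ (hRs hx).2
  have hL₁ : LipschitzOnWith K₁ A B := hK₁.mono fun x hx ↦ (hRs hx).1.1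
  have hL₂ : LipschitzOnWith K₂ (fderiv ℝ A) B := hK₂.mono fun x hx ↦ (hRs hx).1.2
  have hx₀B : x₀ ∈ B := mem_ball_self hR
  -- Trajectories will stay within `a` of `x₀`. The slack in `2 a < R` leaves room for the
  -- approximate solution below, which moves at most `a / 2` further.
  obtain ⟨a, ha0, haR⟩ : ∃ a : ℝ≥0, 0 < a ∧ (a : ℝ) * 2 < R :=
    ⟨(R / 3).toNNReal, by simpa using hR, by rw [Real.coe_toNNReal _ (by positivity)]; linarith⟩
  have haB : closedBall x₀ a ⊆ B := closedBall_subset_ball (by have := a.2; linarith)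
  obtain ⟨C, hC0, hC⟩ : ∃ C : ℝ≥0, 0 < C ∧ ∀ x ∈ B, ‖A x‖ ≤ C := by
    refine ⟨K₁ * R.toNNReal + ‖A x₀‖₊ + 1, by positivity, fun x hx ↦ ?_⟩
    have h1 := hL₁.norm_sub_le hx hx₀B
    have h2 : ‖x - x₀‖ ≤ R := (mem_ball_iff_norm.1 hx).le
    have h3 : ‖A x‖ ≤ ‖A x - A x₀‖ + ‖A x₀‖ := norm_le_norm_sub_add _ _
    have h4 : (K₁ : ℝ) * ‖x - x₀‖ ≤ K₁ * R := by gcongr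
    push_cast
    rw [Real.coe_toNNReal _ hR.le]
    linarith
  obtain ⟨r, hr0, hr1, hrC⟩ : ∃ r : ℝ, 0 < r ∧ r ≤ 1 ∧ C * r ≤ a / 2 := by
    refine ⟨min 1 (a / (2 * C)), by positivity, min_le_left _ _, ?_⟩
    calc (C : ℝ) * min 1 (a / (2 * C)) ≤ C * (a / (2 * C)) := by gcongr; exact min_le_right _ _
      _ = a / 2 := by field_simp
  -- the solutions along rays
  have hex : ∀ v ∈ ball (0 : P) r, ∃ y : ℝ → E, y 0 = x₀ ∧
      (∀ t ∈ Icc (0 : ℝ) 1, y t ∈ closedBall x₀ a) ∧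
      ∀ t ∈ Icc (0 : ℝ) 1, HasDerivWithinAt y (A (y t) v) (Icc 0 1) t := by
    intro v hv
    have hv' : ‖v‖ < r := by simpa using hv
    refine exists_hasDerivWithinAt_Icc_mem_closedBall (f := fun x ↦ A x v)
      (L := C * ‖v‖₊) (K := K₁ * ‖v‖₊) ?_ ?_ ?_
    · rw [← NNReal.coe_le_coe]
      push_cast
      have : (C : ℝ) * ‖v‖ ≤ C * r := by gcongr
      have := a.2
      linarith
    · intro x hx
      push_cast
      exact (A x).le_of_opNorm_le (hC x (haB hx)) v
    · refine LipschitzOnWith.of_dist_le_mul fun x hx y hy ↦ ?_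
      rw [dist_eq_norm, dist_eq_norm, ← sub_apply]
      push_cast
      calc _ ≤ ‖A x - A y‖ * ‖v‖ := ContinuousLinearMap.le_opNorm _ _
        _ ≤ (K₁ * ‖x - y‖) * ‖v‖ := by gcongr; exact hL₁.norm_sub_le (haB hx) (haB hy)
        _ = _ := by ring
  choose! y hy0 hyB hyd using hex
  refine ⟨r, hr0, fun v ↦ y v 1, ?_, fun v hv ↦ ⟨hBU (haB (hyB v hv 1 (by simp))), ?_⟩⟩
  · -- at `v = 0` the solution is constant
    have h0 : (0 : P) ∈ ball (0 : P) r := by simpa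
    have hd : ∀ t ∈ Icc (0 : ℝ) 1, HasDerivWithinAt (y 0) 0 (Icc 0 1) t := by
      simpa using hyd 0 h0
    have := (convex_Icc (0 : ℝ) 1).norm_image_sub_le_of_norm_hasDerivWithin_le (C := 0)
      hd (by simp) (x := 0) (y := 1) (by simp) (by simp)
    rw [zero_mul, norm_le_zero_iff, sub_eq_zero, hy0 0 h0] at this
    exact this
  -- A quadratic error bound proves `dF(v) = A(F v)`. For `u = v + w`, the curve `y v t + t • A (y v
  -- t) w` solves the ODE of `u` up to an error of order `‖w‖ ^ 2`, so Grönwall compares it with `y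
  -- u`.
  have key : ∃ D : ℝ, ∀ᶠ u in 𝓝 v,
      ‖y u 1 - y v 1 - A (y v 1) (u - v)‖ ≤ D * ‖u - v‖ ^ 2 := by
    have hv' : ‖v‖ < r := by simpa using hv
    -- Since `‖u‖ ≤ 1`, the field `x ↦ A x u` is already `K₁`-Lipschitz; adding `1` makes `K`
    -- nonzero, as the closed form of the Grönwall bound requires.
    set K : ℝ≥0 := K₁ + 1
    refine ⟨(K₂ * C ^ 2 + K₁ * C) / K * (Real.exp (K * 1) - 1), ?_⟩
    have hev : ∀ᶠ u in 𝓝 v, u ∈ ball (0 : P) r := isOpen_ball.mem_nhds hv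
    have hev' : ∀ᶠ u in 𝓝 v, ‖u - v‖ < r := by
      have : Filter.Tendsto (fun u ↦ ‖u - v‖) (𝓝 v) (𝓝 0) := by
        simpa using (continuous_id.sub continuous_const).norm.tendsto' v ‖v - v‖ rfl
      exact this.eventually (gt_mem_nhds hr0)
    filter_upwards [hev, hev'] with u hu hu'
    have hunorm : ‖u‖ < r := by simpa using hu
    set w := u - v with hw
    have hu_eq : u = v + w := by simp [hw]
    -- the approximate solution
    set g : ℝ → E := fun t ↦ y v t + t • A (y v t) w with hg
    set g' : ℝ → E := fun t ↦ A (y v t) v +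
      (t • fderiv ℝ A (y v t) (A (y v t) v) w + A (y v t) w) with hg'
    have hyvB : ∀ t ∈ Icc (0 : ℝ) 1, y v t ∈ B := fun t ht ↦ haB (hyB v hv t ht)
    have hyuB : ∀ t ∈ Icc (0 : ℝ) 1, y u t ∈ B := fun t ht ↦ haB (hyB u hu t ht)
    have hAd : ∀ x ∈ B, HasFDerivAt A (fderiv ℝ A x) x := fun x hx ↦
      ((hA.contDiffAt (hU.mem_nhds (hBU hx))).differentiableAt (by norm_num)).hasFDerivAt
    have hgd : ∀ t ∈ Icc (0 : ℝ) 1, HasDerivWithinAt g (g' t) (Icc 0 1) t := by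
      intro t ht
      have h1 := hyd v hv t ht
      have h2 : HasDerivWithinAt (fun t ↦ A (y v t)) (fderiv ℝ A (y v t) (A (y v t) v))
          (Icc 0 1) t := (hAd _ (hyvB t ht)).comp_hasDerivWithinAt t h1
      have h3 : HasDerivWithinAt (fun t ↦ A (y v t) w) (fderiv ℝ A (y v t) (A (y v t) v) w)
          (Icc 0 1) t := by
        simpa using h2.clm_apply (hasDerivWithinAt_const t (Icc 0 1) w)
      simpa [hg, hg'] using! h1.add ((hasDerivWithinAt_id t (Icc 0 1)).smul h3)
    have hstep : ∀ t ∈ Icc (0 : ℝ) 1, ‖g t - y v t‖ ≤ C * ‖w‖ := by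
      intro t ht
      simp only [hg, add_sub_cancel_left, norm_smul, Real.norm_of_nonneg ht.1]
      calc t * ‖A (y v t) w‖ ≤ 1 * (C * ‖w‖) := by
            gcongr
            · exact ht.2
            · exact (A _).le_of_opNorm_le (hC _ (hyvB t ht)) w
        _ = _ := one_mul _
    have hgB : ∀ t ∈ Icc (0 : ℝ) 1, g t ∈ B := by
      intro t ht
      have h1 := hstep t ht
      have h2 : ‖y v t - x₀‖ ≤ a := mem_closedBall_iff_norm.1 (hyB v hv t ht)
      have h3 : ‖g t - x₀‖ ≤ ‖g t - y v t‖ + ‖y v t - x₀‖ := norm_sub_le_norm_sub_add_norm_sub ..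
      have h4 : (C : ℝ) * ‖w‖ ≤ C * r := by gcongr
      have := a.2
      exact mem_ball_iff_norm.2 (by linarith)
    have hIci : ∀ {z z' : ℝ → E}, (∀ t ∈ Icc (0 : ℝ) 1, HasDerivWithinAt z (z' t) (Icc 0 1) t) →
        ∀ t ∈ Ico (0 : ℝ) 1, HasDerivWithinAt z (z' t) (Ici t) t := fun h t ht ↦
      (h t ⟨ht.1, ht.2.le⟩).mono_of_mem_nhdsWithin
        (Filter.mem_of_superset (Icc_mem_nhdsGE ht.2) (Icc_subset_Icc ht.1 le_rfl))
    have hbound : ∀ t ∈ Ico (0 : ℝ) 1, dist (g' t) (A (g t) u) ≤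
        (K₂ * C ^ 2 + K₁ * C) * ‖w‖ ^ 2 := by
      intro t ht
      have ht' : t ∈ Icc (0 : ℝ) 1 := ⟨ht.1, ht.2.le⟩
      have hgy : g t - y v t = t • A (y v t) w := by simp [hg]
      -- This is where commutation enters: it turns `DA(A v) w` into `DA(A w) v`, the first-order
      -- Taylor term of `A (g t) v`. A Taylor remainder and a Lipschitz error times `w` are left,
      -- both quadratic in `w`.
      have e1 : g' t - A (g t) u =
          -((A (g t) - A (y v t) - fderiv ℝ A (y v t) (g t - y v t)) v)
            - (A (g t) - A (y v t)) w := by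
        rw [hgy, hu_eq, map_smul]
        simp only [hg', sub_apply, smul_apply, map_add,
          hcomm _ (hBU (hyvB t ht')) v w]
        abel
      have e2 := norm_sub_sub_fderiv_le (convex_ball x₀ R) isOpen_ball
        (fun x hx ↦ (hAd x hx).differentiableAt.differentiableWithinAt) hL₂ (hyvB t ht')
        (hgB t ht')
      have e3 := hL₁.norm_sub_le (hgB t ht') (hyvB t ht')
      have e4 := hstep t ht'
      rw [dist_eq_norm, e1]
      refine (norm_sub_le _ _).trans ?_
      rw [norm_neg]
      calc _ ≤ (K₂ * ‖g t - y v t‖ ^ 2) * ‖v‖ + (K₁ * ‖g t - y v t‖) * ‖w‖ :=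
            add_le_add (ContinuousLinearMap.le_of_opNorm_le _ e2 _)
              (ContinuousLinearMap.le_of_opNorm_le _ e3 _)
        _ ≤ (K₂ * (C * ‖w‖) ^ 2) * 1 + (K₁ * (C * ‖w‖)) * ‖w‖ := by
            gcongr
            linarith
        _ = _ := by ring
    have hgron := dist_le_of_approx_trajectories_ODE_of_mem (v := fun _ x ↦ A x u) (K := K)
      (s := fun _ ↦ B) (a := 0) (b := 1) (f := y u) (g := g) (εf := 0) (δ := 0)
      (fun t _ ↦ LipschitzOnWith.of_dist_le_mul fun x hx z hz ↦ ?_)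
      (fun t ht ↦ (hyd u hu t ht).continuousWithinAt) (hIci (hyd u hu))
      (fun t _ ↦ by rw [dist_self]) (fun t ht ↦ hyuB t ⟨ht.1, ht.2.le⟩)
      (fun t ht ↦ (hgd t ht).continuousWithinAt) (hIci hgd) hbound
      (fun t ht ↦ hgB t ⟨ht.1, ht.2.le⟩) (by simp [hg, hy0 u hu, hy0 v hv]) 1 (by simp)
    · have hK0 : (K : ℝ) ≠ 0 := by positivity
      rw [gronwallBound_of_K_ne_0 hK0, dist_eq_norm] at hgron
      have : y u 1 - g 1 = y u 1 - y v 1 - A (y v 1) w := by simp [hg]; abel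
      rw [this] at hgron
      refine hgron.trans (le_of_eq ?_)
      simp
      ring
    · rw [dist_eq_norm, dist_eq_norm, ← sub_apply]
      calc _ ≤ ‖A x - A z‖ * ‖u‖ := ContinuousLinearMap.le_opNorm _ _
        _ ≤ (K₁ * ‖x - z‖) * 1 := by
            gcongr
            · exact hL₁.norm_sub_le hx hz
            · linarith
        _ ≤ K * ‖x - z‖ := by
            rw [mul_one]
            gcongr
            exact le_self_add
  obtain ⟨D, hD⟩ := key
  have h0 : HasFDerivAt (fun u ↦ y u 1 - y v 1 - A (y v 1) (u - v)) (0 : P →L[ℝ] E) v := by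
    refine Asymptotics.IsBigO.hasFDerivAt (n := 2) (Asymptotics.IsBigO.of_bound D ?_) one_lt_two
    filter_upwards [hD] with u hu
    simpa using hu
  have h1 : HasFDerivAt (fun u ↦ y v 1 + A (y v 1) (u - v)) (A (y v 1)) v :=
    ((A (y v 1)).hasFDerivAt.comp v ((hasFDerivAt_id v).sub_const v)).const_add _
  have h2 := h0.add h1
  rw [zero_add] at h2
  refine h2.congr_of_eventuallyEq (Filter.Eventually.of_forall fun u ↦ ?_)
  simp

/-- Bootstrapping: solutions of `dF = A(F)` are as smooth as `A`. -/
theorem contDiffOn_of_hasFDerivAt {A : E → P →L[ℝ] E} {U : Set E} (hA : ContDiffOn ℝ ∞ A U)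
    {F : P → E} {s : Set P} (hs : IsOpen s)
    (hF : ∀ v ∈ s, F v ∈ U ∧ HasFDerivAt F (A (F v)) v) : ContDiffOn ℝ ∞ F s := by
  have hd : DifferentiableOn ℝ F s := fun v hv ↦
    (hF v hv).2.differentiableAt.differentiableWithinAt
  rw [contDiffOn_infty]
  intro n
  induction n with
  | zero => exact contDiffOn_zero.2 hd.continuousOn
  | succ n ih =>
    push_cast
    -- The derivative of `F` is `A ∘ F`, so each order of smoothness of `F` yields the next.
    rw [contDiffOn_succ_iff_fderiv_of_isOpen hs]
    refine ⟨hd, by simp, ?_⟩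
    have h1 : ContDiffOn ℝ n (fun v ↦ A (F v)) s :=
      (hA.of_le (by exact_mod_cast le_top)).comp ih fun v hv ↦ (hF v hv).1
    exact h1.congr fun v hv ↦ (hF v hv).2.fderiv

end TotalDifferential

/-! ### Kernels of alternating forms -/

section AlgebraKernel

variable {V : Type*} [AddCommGroup V] [Module ℝ V]

/-- `v` lies in the kernel of `a`: the contraction of `a` with `v` vanishes. -/
def Annihilates {n : ℕ} (v : V) (a : V [⋀^Fin n]→ₗ[ℝ] ℝ) : Prop :=
  ∀ (w : Fin n → V) (i : Fin n), w i = v → a w = 0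

/-- Every shuffle hands `v` to one of the two factors, so each summand vanishes. -/
theorem Annihilates.wedge {m n : ℕ} {v : V} {a : V [⋀^Fin m]→ₗ[ℝ] ℝ} {b : V [⋀^Fin n]→ₗ[ℝ] ℝ}
    (ha : Annihilates v a) (hb : Annihilates v b) : Annihilates v (wedge a b) := by
  intro w i hi
  obtain ⟨j, rfl⟩ := finSumFinEquiv.surjective i
  simp only [ContactPair.wedge, AlternatingMap.domDomCongr_apply,
    LinearMap.compAlternatingMap_apply, AlternatingMap.domCoprod_apply, sum_apply,
    map_sum]
  refine Finset.sum_eq_zero fun σ _ ↦ ?_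
  induction σ using Quotient.inductionOn' with | h σ =>
  rw [AlternatingMap.domCoprod.summand_mk'']
  simp only [smul_apply, MultilinearMap.domDomCongr_apply,
    MultilinearMap.domCoprod_apply, AlternatingMap.coe_multilinearMap]
  have : LinearMap.mul' ℝ ℝ (a (fun i ↦ (w ∘ finSumFinEquiv) (σ (Sum.inl i))) ⊗ₜ[ℝ]
      b fun i ↦ (w ∘ finSumFinEquiv) (σ (Sum.inr i))) = 0 := by
    rw [LinearMap.mul'_apply]
    rcases h : σ.symm j with l | l
    · rw [ha _ l (by rw [← h]; simpa using hi), zero_mul]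
    · rw [hb _ l (by rw [← h]; simpa using hi), mul_zero]
  have h2 := congrArg (fun r ↦ Equiv.Perm.sign σ • r) this
  simpa using h2

theorem Annihilates.wedgePow {v : V} {a : V [⋀^Fin 2]→ₗ[ℝ] ℝ} (ha : Annihilates v a) (k : ℕ) :
    Annihilates v (wedgePow a k) := by
  induction k with
  | zero => exact fun w i ↦ i.elim0
  | succ k ih => exact ih.wedge ha

theorem annihilates_ofSubsingleton {v : V} {f : V →ₗ[ℝ] ℝ} (hf : f v = 0) :
    Annihilates v (AlternatingMap.ofSubsingleton ℝ V ℝ (0 : Fin 1) f) := by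
  intro w i hi
  obtain rfl : i = 0 := Subsingleton.elim _ _
  simpa [hi] using hf

theorem annihilates_two {v : V} {a : V [⋀^Fin 2]→ₗ[ℝ] ℝ} (ha : ∀ w, a ![v, w] = 0) :
    Annihilates v a := by
  intro w i hi
  fin_cases i
  · have : w = ![v, w 1] := by ext j; fin_cases j <;> simp [← hi]
    rw [this, ha]
  · have : w = ![v, w 0] ∘ Equiv.swap 0 1 := by ext j; fin_cases j <;> simp [← hi]
    rw [this, AlternatingMap.map_swap _ _ (by decide), ha, neg_zero]

/-- A nonzero form of top degree has trivial kernel. -/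
theorem eq_zero_of_annihilates {n : ℕ} (hn : Module.finrank ℝ V = n) (hn0 : 0 < n) {v : V}
    {a : V [⋀^Fin n]→ₗ[ℝ] ℝ} (ha : a ≠ 0) (hv : Annihilates v a) : v = 0 := by
  by_contra hv0
  have : FiniteDimensional ℝ V := Module.finite_of_finrank_pos (hn ▸ hn0)
  have hli : LinearIndepOn ℝ id ({v} : Set V) := LinearIndepOn.singleton hv0
  let b := Module.Basis.extend hli
  have hmem : v ∈ hli.extend (subset_univ _) := hli.subset_extend _ rfl
  have : Fintype (hli.extend (subset_univ _)) := FiniteDimensional.fintypeBasisIndex b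
  have hcard : Fintype.card (hli.extend (subset_univ _)) = Fintype.card (Fin n) := by
    rw [← Module.finrank_eq_card_basis b, hn, Fintype.card_fin]
  -- An alternating form is determined by its values on injective families of basis vectors. With
  -- `n` indices such a family is a bijection onto the basis, so it contains `v`.
  refine ha (Module.Basis.ext_alternating b fun f hf ↦ ?_)
  obtain ⟨i, hi⟩ := ((Fintype.bijective_iff_injective_and_card f).2 ⟨hf, hcard.symm⟩).2 ⟨v, hmem⟩
  rw [hv _ i (by rw [hi]; exact Module.Basis.extend_apply_self hli _), AlternatingMap.zero_apply]

end AlgebraKernel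

section ContactPairKernel

variable {E : Type*} [NormedAddCommGroup E] [NormedSpace ℝ E]
  {M : Type*} [TopologicalSpace M] [ChartedSpace E M] [IsManifold 𝓘(ℝ, E) ∞ M]

/-- A vector in the kernel of all the factors lies in the kernel of the volume form. This
nondegeneracy forces the Reeb fields to commute. -/
theorem IsContactPair.eq_zero {h k : ℕ} {α : Fin 2 → Π x : M, TangentSpace 𝓘(ℝ, E) x →L[ℝ] ℝ}
    (hα : IsContactPair h k (α 0) (α 1)) {x : M} {v : TangentSpace 𝓘(ℝ, E) x}
    (h0 : ∀ i, α i x v = 0) (hd : ∀ i w, extDerivOne (α i) x ![v, w] = 0) : v = 0 := by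
  refine eq_zero_of_annihilates (V := TangentSpace 𝓘(ℝ, E) x) hα.top_degree (by omega)
    (hα.volume_ne_zero x) ?_
  exact (((annihilates_ofSubsingleton (h0 0)).wedge
    ((annihilates_two (hd 0)).wedgePow h)).wedge (annihilates_ofSubsingleton (h0 1))).wedge
    ((annihilates_two (hd 1)).wedgePow k)

end ContactPairKernel

/-! ### Smooth fields and forms, and their expressions in charts -/

section Charts

section NoSmoothness

variable {E : Type*} [NormedAddCommGroup E] [NormedSpace ℝ E]
  {M : Type*} [TopologicalSpace M] [ChartedSpace E M]

theorem mfderiv_extChartAt_symm (x : M) (y : E) :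
    mfderiv 𝓘(ℝ, E) 𝓘(ℝ, E) (extChartAt 𝓘(ℝ, E) x).symm y =
      mfderivWithin 𝓘(ℝ, E) 𝓘(ℝ, E) (extChartAt 𝓘(ℝ, E) x).symm (range 𝓘(ℝ, E)) y := by
  rw [ModelWithCorners.range_eq_univ, mfderivWithin_univ]

theorem extChartAt_target_mem_nhds_of_mem {x : M} {y : E}
    (hy : y ∈ (extChartAt 𝓘(ℝ, E) x).target) : (extChartAt 𝓘(ℝ, E) x).target ∈ 𝓝 y :=
  (isOpen_extChartAt_target x).mem_nhds hy

end NoSmoothness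

variable {E : Type*} [NormedAddCommGroup E] [NormedSpace ℝ E]
  {M : Type*} [TopologicalSpace M] [ChartedSpace E M] [IsManifold 𝓘(ℝ, E) ∞ M]

instance : IsManifold 𝓘(ℝ, E) (minSmoothness ℝ 2) M := by
  rw [minSmoothness_of_isRCLikeNormedField]
  exact IsManifold.of_le (n := ∞) ENat.LEInfty.out

instance : IsManifold 𝓘(ℝ, E) (minSmoothness ℝ 3) M := by
  rw [minSmoothness_of_isRCLikeNormedField]
  exact IsManifold.of_le (n := ∞) ENat.LEInfty.out

theorem SmoothOneForm.contMDiffAt_apply {α : Π x : M, TangentSpace 𝓘(ℝ, E) x →L[ℝ] ℝ}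
    (hα : SmoothOneForm α) {X : Π x : M, TangentSpace 𝓘(ℝ, E) x} {x : M}
    (hX : ContMDiffAt 𝓘(ℝ, E) (𝓘(ℝ, E).prod 𝓘(ℝ, E)) ∞
      (fun x ↦ (TotalSpace.mk' E x (X x) : TangentBundle 𝓘(ℝ, E) M)) x) :
    ContMDiffAt 𝓘(ℝ, E) 𝓘(ℝ, ℝ) ∞ (fun x ↦ α x (X x)) x := by
  have h := ContMDiffAt.clm_bundle_apply (E₂ := Bundle.Trivial M ℝ) (b := id) (hα x) hX
  simpa using (Bundle.contMDiffAt_section _).1 h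

theorem SmoothOneForm.contMDiff_apply {α : Π x : M, TangentSpace 𝓘(ℝ, E) x →L[ℝ] ℝ}
    (hα : SmoothOneForm α) {X : Π x : M, TangentSpace 𝓘(ℝ, E) x} (hX : SmoothField X) :
    ContMDiff 𝓘(ℝ, E) 𝓘(ℝ, ℝ) ∞ (fun x ↦ α x (X x)) :=
  fun x ↦ hα.contMDiffAt_apply (hX x)

theorem SmoothEndo.smoothField_apply
    {φ : Π x : M, TangentSpace 𝓘(ℝ, E) x →L[ℝ] TangentSpace 𝓘(ℝ, E) x}
    (hφ : SmoothEndo φ) {X : Π x : M, TangentSpace 𝓘(ℝ, E) x} (hX : SmoothField X) :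
    SmoothField (fun x ↦ φ x (X x)) :=
  ContMDiff.clm_bundle_apply (b := id) hφ hX

theorem SmoothField.contMDiff_mvfderiv {X : Π x : M, TangentSpace 𝓘(ℝ, E) x}
    (hX : SmoothField X) {f : M → ℝ} (hf : ContMDiff 𝓘(ℝ, E) 𝓘(ℝ, ℝ) ∞ f) :
    ContMDiff 𝓘(ℝ, E) 𝓘(ℝ, ℝ) ∞ (fun x ↦ mvfderiv 𝓘(ℝ, E) f x (X x)) := by
  have h1 := hf.contMDiff_tangentMap (m := ∞) le_rfl
  exact (contMDiff_snd_tangentBundle_modelSpace ℝ 𝓘(ℝ, ℝ)).comp (h1.comp hX)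

theorem SmoothField.mlieBracket [CompleteSpace E] {X Y : Π x : M, TangentSpace 𝓘(ℝ, E) x}
    (hX : SmoothField X) (hY : SmoothField Y) :
    SmoothField (VectorField.mlieBracket 𝓘(ℝ, E) X Y) :=
  have : IsManifold 𝓘(ℝ, E) (((⊤ : ℕ∞) : ℕ∞ω) + 1) M := ‹IsManifold 𝓘(ℝ, E) ∞ M›
  fun x ↦ ContMDiffAt.mlieBracket_vectorField (m := ⊤) (n := ⊤) (hX x) (hY x) (by simp)

theorem SmoothField.mdifferentiableAt {X : Π x : M, TangentSpace 𝓘(ℝ, E) x}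
    (hX : SmoothField X) (x : M) :
    MDifferentiableAt 𝓘(ℝ, E) (𝓘(ℝ, E).prod 𝓘(ℝ, E))
      (fun x ↦ (TotalSpace.mk' E x (X x) : TangentBundle 𝓘(ℝ, E) M)) x :=
  (hX x).mdifferentiableAt (by simp)

/-- Every tangent vector extends to a smooth vector field. -/
theorem exists_smoothField_eq [FiniteDimensional ℝ E] [T2Space M] {x : M}
    (v : TangentSpace 𝓘(ℝ, E) x) :
    ∃ X : Π y : M, TangentSpace 𝓘(ℝ, E) y, SmoothField X ∧ X x = v := by
  obtain ⟨s, hs, hv⟩ := FiberBundle.exists_contMDiffOn_extend (k := ∞) 𝓘(ℝ, E) E v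
  obtain ⟨f, -, hf⟩ := ((SmoothBumpFunction.nhds_basis_tsupport (I := 𝓘(ℝ, E)) x).mem_iff).1
    (interior_mem_nhds.2 hs)
  refine ⟨fun y ↦ f y • FiberBundle.extend E v y, fun y ↦ ?_, by simp⟩
  by_cases hy : y ∈ tsupport f
  · exact ContMDiffAt.smul_section f.contMDiffAt
      (hv.contMDiffAt (mem_interior_iff_mem_nhds.1 (hf hy)))
  · have h0 : (fun y : M ↦ (TotalSpace.mk' E y (f y • FiberBundle.extend E v y) :
        TangentBundle 𝓘(ℝ, E) M)) =ᶠ[𝓝 y] zeroSection E (TangentSpace 𝓘(ℝ, E)) := by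
      filter_upwards [(isClosed_tsupport f).isOpen_compl.mem_nhds hy] with z hz
      simp [image_eq_zero_of_notMem_tsupport hz, zeroSection]
    exact (Bundle.contMDiff_zeroSection ℝ (TangentSpace 𝓘(ℝ, E) : M → Type _)
      y).congr_of_eventuallyEq h0

/-! ### Reading fields and forms in a chart -/

/-- The vector field `X` read in the preferred chart at `x`. -/
def chartField (x : M) (X : Π y : M, TangentSpace 𝓘(ℝ, E) y) : E → E :=
  VectorField.mpullback 𝓘(ℝ, E) 𝓘(ℝ, E) (extChartAt 𝓘(ℝ, E) x).symm X

theorem isInvertible_mfderiv_extChartAt_symm {x : M} {y : E}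
    (hy : y ∈ (extChartAt 𝓘(ℝ, E) x).target) :
    (mfderiv 𝓘(ℝ, E) 𝓘(ℝ, E) (extChartAt 𝓘(ℝ, E) x).symm y).IsInvertible := by
  rw [mfderiv_extChartAt_symm]
  have : IsManifold 𝓘(ℝ, E) 1 M := IsManifold.of_le (n := ∞) (by simp)
  exact isInvertible_mfderivWithin_extChartAt_symm hy

theorem contMDiffAt_extChartAt_symm {x : M} {y : E}
    (hy : y ∈ (extChartAt 𝓘(ℝ, E) x).target) :
    ContMDiffAt 𝓘(ℝ, E) 𝓘(ℝ, E) ∞ (extChartAt 𝓘(ℝ, E) x).symm y :=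
  (contMDiffOn_extChartAt_symm x).contMDiffAt (extChartAt_target_mem_nhds_of_mem hy)

theorem mfderiv_extChartAt_symm_apply_chartField {x : M} (X : Π y : M, TangentSpace 𝓘(ℝ, E) y)
    {y : E} (hy : y ∈ (extChartAt 𝓘(ℝ, E) x).target) :
    mfderiv 𝓘(ℝ, E) 𝓘(ℝ, E) (extChartAt 𝓘(ℝ, E) x).symm y (chartField x X y : E) =
      X ((extChartAt 𝓘(ℝ, E) x).symm y) :=
  (isInvertible_mfderiv_extChartAt_symm hy).self_apply_inverse _

theorem mfderiv_extChartAt_apply {x : M} (X : Π y : M, TangentSpace 𝓘(ℝ, E) y)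
    {z : M} (hz : z ∈ (extChartAt 𝓘(ℝ, E) x).source) :
    mfderiv 𝓘(ℝ, E) 𝓘(ℝ, E) (extChartAt 𝓘(ℝ, E) x) z (X z) =
      (chartField x X (extChartAt 𝓘(ℝ, E) x z) : E) := by
  have : IsManifold 𝓘(ℝ, E) 1 M := IsManifold.of_le (n := ∞) (by simp)
  have hy := (extChartAt 𝓘(ℝ, E) x).map_source hz
  apply (isInvertible_mfderiv_extChartAt_symm hy).injective
  rw [mfderiv_extChartAt_symm_apply_chartField X hy, mfderiv_extChartAt_symm,
    (extChartAt 𝓘(ℝ, E) x).left_inv hz]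
  exact congr($(mfderivWithin_extChartAt_symm_comp_mfderiv_extChartAt' hz) (X z))

theorem contDiffAt_chartField [CompleteSpace E] {x : M} {X : Π y : M, TangentSpace 𝓘(ℝ, E) y}
    {y : E} (hy : y ∈ (extChartAt 𝓘(ℝ, E) x).target)
    (hX : ContMDiffAt 𝓘(ℝ, E) (𝓘(ℝ, E).prod 𝓘(ℝ, E)) ∞
      (fun x ↦ (TotalSpace.mk' E x (X x) : TangentBundle 𝓘(ℝ, E) M))
      ((extChartAt 𝓘(ℝ, E) x).symm y)) :
    ContDiffAt ℝ ∞ (chartField x X) y :=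
  contMDiffAt_vectorSpace_iff_contDiffAt.1
    (ContMDiffAt.mpullback_vectorField_preimage hX (contMDiffAt_extChartAt_symm hy)
      (isInvertible_mfderiv_extChartAt_symm hy) (by simp))

theorem chartField_mlieBracket [CompleteSpace E] {x : M} {X Y : Π y : M, TangentSpace 𝓘(ℝ, E) y}
    {y : E} (hy : y ∈ (extChartAt 𝓘(ℝ, E) x).target) (hX : SmoothField X) (hY : SmoothField Y) :
    chartField x (VectorField.mlieBracket 𝓘(ℝ, E) X Y) y =
      VectorField.lieBracket ℝ (chartField x X) (chartField x Y) y := by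
  have h := VectorField.mpullback_mlieBracket (hX.mdifferentiableAt _) (hY.mdifferentiableAt _)
    (contMDiffAt_extChartAt_symm hy) (by simpa using ENat.LEInfty.out)
  have h2 := congrFun (VectorField.mlieBracketWithin_eq_lieBracketWithin (𝕜 := ℝ)
    (V := chartField x X) (W := chartField x Y) (s := univ)) y
  rw [VectorField.lieBracketWithin_univ] at h2
  exact h.trans h2

theorem mvfderiv_symm_apply {x : M} {y : E} (hy : y ∈ (extChartAt 𝓘(ℝ, E) x).target) {f : M → ℝ}
    (hf : ContMDiff 𝓘(ℝ, E) 𝓘(ℝ, ℝ) ∞ f) (X : Π y : M, TangentSpace 𝓘(ℝ, E) y) :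
    mvfderiv 𝓘(ℝ, E) f ((extChartAt 𝓘(ℝ, E) x).symm y) (X ((extChartAt 𝓘(ℝ, E) x).symm y)) =
      fderiv ℝ (f ∘ (extChartAt 𝓘(ℝ, E) x).symm) y (chartField x X y) := by
  rw [← mfderiv_eq_fderiv, mfderiv_comp y ((hf _).mdifferentiableAt (by simp))
    ((contMDiffAt_extChartAt_symm hy).mdifferentiableAt (by simp)),
    ← mfderiv_extChartAt_symm_apply_chartField X hy]
  rfl

theorem contDiffAt_comp_symm {x : M} {y : E} (hy : y ∈ (extChartAt 𝓘(ℝ, E) x).target) {f : M → ℝ}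
    (hf : ContMDiff 𝓘(ℝ, E) 𝓘(ℝ, ℝ) ∞ f) :
    ContDiffAt ℝ ∞ (f ∘ (extChartAt 𝓘(ℝ, E) x).symm) y :=
  contMDiffAt_iff_contDiffAt.1 ((hf _).comp y (contMDiffAt_extChartAt_symm hy))

/-- `[X, Y] f = X (Y f) - Y (X f)`. -/
theorem mvfderiv_mlieBracket [CompleteSpace E] {X Y : Π y : M, TangentSpace 𝓘(ℝ, E) y}
    (hX : SmoothField X) (hY : SmoothField Y) {f : M → ℝ}
    (hf : ContMDiff 𝓘(ℝ, E) 𝓘(ℝ, ℝ) ∞ f) (x : M) :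
    mvfderiv 𝓘(ℝ, E) f x (VectorField.mlieBracket 𝓘(ℝ, E) X Y x) =
      mvfderiv 𝓘(ℝ, E) (fun y ↦ mvfderiv 𝓘(ℝ, E) f y (Y y)) x (X x) -
      mvfderiv 𝓘(ℝ, E) (fun y ↦ mvfderiv 𝓘(ℝ, E) f y (X y)) x (Y x) := by
  have hy : extChartAt 𝓘(ℝ, E) x x ∈ (extChartAt 𝓘(ℝ, E) x).target := mem_extChartAt_target x
  obtain ⟨z, hz⟩ : ∃ z, z = extChartAt 𝓘(ℝ, E) x x := ⟨_, rfl⟩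
  have hx : x = (extChartAt 𝓘(ℝ, E) x).symm z := by rw [hz, extChartAt_to_inv]
  rw [← hz] at hy
  have key : ∀ W : Π y : M, TangentSpace 𝓘(ℝ, E) y, ∀ {u : M → ℝ},
      ContMDiff 𝓘(ℝ, E) 𝓘(ℝ, ℝ) ∞ u → mvfderiv 𝓘(ℝ, E) u x (W x) =
        fderiv ℝ (u ∘ (extChartAt 𝓘(ℝ, E) x).symm) z (chartField x W z) := by
    intro W u hu
    have := mvfderiv_symm_apply hy hu W
    rwa [← hx] at this
  have hF := contDiffAt_comp_symm hy hf
  have h2 : ∀ {W : Π y : M, TangentSpace 𝓘(ℝ, E) y}, SmoothField W → ∀ v,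
      fderiv ℝ ((fun y ↦ mvfderiv 𝓘(ℝ, E) f y (W y)) ∘ (extChartAt 𝓘(ℝ, E) x).symm) z v =
      fderiv ℝ (fderiv ℝ (f ∘ (extChartAt 𝓘(ℝ, E) x).symm)) z v (chartField x W z) +
      fderiv ℝ (f ∘ (extChartAt 𝓘(ℝ, E) x).symm) z (fderiv ℝ (chartField x W) z v) := by
    intro W hW v
    have e : (fun y ↦ mvfderiv 𝓘(ℝ, E) f y (W y)) ∘ (extChartAt 𝓘(ℝ, E) x).symm =ᶠ[𝓝 z]
        fun y ↦ fderiv ℝ (f ∘ (extChartAt 𝓘(ℝ, E) x).symm) y (chartField x W y) := by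
      filter_upwards [extChartAt_target_mem_nhds_of_mem hy] with y hy'
      exact mvfderiv_symm_apply hy' hf W
    rw [e.fderiv_eq, fderiv_clm_apply]
    · simp [add_comm]
    · exact (hF.fderiv_right (m := 1) (by norm_cast)).differentiableAt (by simp)
    · exact (contDiffAt_chartField hy (hW _)).differentiableAt (by simp)
  -- The second-order terms cancel by symmetry of the second derivative; the first-order ones form
  -- the bracket in the chart.
  rw [key _ hf, key X (hY.contMDiff_mvfderiv hf), key Y (hX.contMDiff_mvfderiv hf), h2 hX, h2 hY,
    chartField_mlieBracket hy hX hY, VectorField.lieBracket, map_sub,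
    (hF.isSymmSndFDerivAt (by simpa using ENat.LEInfty.out)).eq]
  ring

theorem contMDiffAt_mpullback_extChartAt [CompleteSpace E] {x z : M}
    (hz : z ∈ (extChartAt 𝓘(ℝ, E) x).source) (v : E) :
    ContMDiffAt 𝓘(ℝ, E) (𝓘(ℝ, E).prod 𝓘(ℝ, E)) ∞
      (fun y ↦ (TotalSpace.mk' E y (VectorField.mpullback 𝓘(ℝ, E) 𝓘(ℝ, E)
        (extChartAt 𝓘(ℝ, E) x) (fun _ : E ↦ v) y) : TangentBundle 𝓘(ℝ, E) M)) z := by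
  have : IsManifold 𝓘(ℝ, E) 1 M := IsManifold.of_le (n := ∞) (by simp)
  have hz' : z ∈ (chartAt E x).source := by rwa [extChartAt_source] at hz
  exact ContMDiffAt.mpullback_vectorField_preimage (n := ∞)
    (contMDiffAt_vectorSpace_iff_contDiffAt.2 contDiffAt_const)
    (contMDiffAt_extChartAt' hz') (isInvertible_mfderiv_extChartAt hz) (by simp)

theorem mpullback_extChartAt_symm {x : M} {y : E} (hy : y ∈ (extChartAt 𝓘(ℝ, E) x).target)
    (v : E) : VectorField.mpullback 𝓘(ℝ, E) 𝓘(ℝ, E) (extChartAt 𝓘(ℝ, E) x) (fun _ : E ↦ v)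
      ((extChartAt 𝓘(ℝ, E) x).symm y) =
      mfderiv 𝓘(ℝ, E) 𝓘(ℝ, E) (extChartAt 𝓘(ℝ, E) x).symm y v := by
  have : IsManifold 𝓘(ℝ, E) 1 M := IsManifold.of_le (n := ∞) (by simp)
  refine (ContinuousLinearMap.IsInvertible.inverse_apply_eq
    (isInvertible_mfderiv_extChartAt ((extChartAt 𝓘(ℝ, E) x).map_target hy))).2 ?_
  rw [mfderiv_extChartAt_symm]
  exact congr($(mfderiv_extChartAt_comp_mfderivWithin_extChartAt_symm hy) v).symm

/-- In finite dimension it suffices to test on constant vectors `v`, whose pullbacks to `M` are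
smooth on the chart domain. -/
theorem contDiffOn_chartForm [FiniteDimensional ℝ E]
    {α : Π x : M, TangentSpace 𝓘(ℝ, E) x →L[ℝ] ℝ} (hα : SmoothOneForm α) (x : M) :
    ContDiffOn ℝ ∞ (fun y : E ↦ ((α ((extChartAt 𝓘(ℝ, E) x).symm y)).comp
        (mfderiv 𝓘(ℝ, E) 𝓘(ℝ, E) (extChartAt 𝓘(ℝ, E) x).symm y) : E →L[ℝ] ℝ))
      (extChartAt 𝓘(ℝ, E) x).target := by
  have : CompleteSpace E := FiniteDimensional.complete ℝ E
  rw [contDiffOn_clm_apply]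
  intro v
  set W : Π y : M, TangentSpace 𝓘(ℝ, E) y := VectorField.mpullback 𝓘(ℝ, E) 𝓘(ℝ, E)
    (extChartAt 𝓘(ℝ, E) x) (fun _ : E ↦ v) with hW
  have h1 : ∀ z ∈ (extChartAt 𝓘(ℝ, E) x).source,
      ContMDiffAt 𝓘(ℝ, E) 𝓘(ℝ, ℝ) ∞ (fun z ↦ α z (W z)) z :=
    fun z hz ↦ hα.contMDiffAt_apply (contMDiffAt_mpullback_extChartAt hz v)
  have h2 : ContDiffOn ℝ ∞ ((fun z ↦ α z (W z)) ∘ (extChartAt 𝓘(ℝ, E) x).symm)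
      (extChartAt 𝓘(ℝ, E) x).target := fun y hy ↦
    (contMDiffAt_iff_contDiffAt.1 ((h1 _ ((extChartAt 𝓘(ℝ, E) x).map_target hy)).comp y
      (contMDiffAt_extChartAt_symm hy))).contDiffWithinAt
  refine h2.congr fun y hy ↦ ?_
  simp only [Function.comp_apply, hW, mpullback_extChartAt_symm hy]
  rfl

/-- `dα(X, Y) = X (α Y) - Y (α X) - α [X, Y]`. -/
theorem extDerivOne_apply [FiniteDimensional ℝ E]
    {α : Π x : M, TangentSpace 𝓘(ℝ, E) x →L[ℝ] ℝ} (hα : SmoothOneForm α)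
    {X Y : Π y : M, TangentSpace 𝓘(ℝ, E) y} (hX : SmoothField X) (hY : SmoothField Y) (x : M) :
    extDerivOne α x ![X x, Y x] =
      mvfderiv 𝓘(ℝ, E) (fun y ↦ α y (Y y)) x (X x) - mvfderiv 𝓘(ℝ, E) (fun y ↦ α y (X y)) x (Y x)
        - α x (VectorField.mlieBracket 𝓘(ℝ, E) X Y x) := by
  have : CompleteSpace E := FiniteDimensional.complete ℝ E
  have hy : extChartAt 𝓘(ℝ, E) x x ∈ (extChartAt 𝓘(ℝ, E) x).target := mem_extChartAt_target x
  have hη := ((contDiffOn_chartForm hα x).contDiffAt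
    (extChartAt_target_mem_nhds_of_mem hy)).differentiableAt (by simp)
  have hXx := mfderiv_extChartAt_apply X (mem_extChartAt_source (I := 𝓘(ℝ, E)) x)
  have hYx := mfderiv_extChartAt_apply Y (mem_extChartAt_source (I := 𝓘(ℝ, E)) x)
  obtain ⟨z, hz⟩ : ∃ z, z = extChartAt 𝓘(ℝ, E) x x := ⟨_, rfl⟩
  have hx : x = (extChartAt 𝓘(ℝ, E) x).symm z := by rw [hz, extChartAt_to_inv]
  rw [extDerivOne, ← hz]
  rw [← hz] at hy hη hXx hYx
  have key : ∀ W : Π y : M, TangentSpace 𝓘(ℝ, E) y, ∀ {u : M → ℝ},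
      ContMDiff 𝓘(ℝ, E) 𝓘(ℝ, ℝ) ∞ u → mvfderiv 𝓘(ℝ, E) u x (W x) =
        fderiv ℝ (u ∘ (extChartAt 𝓘(ℝ, E) x).symm) z (chartField x W z) := by
    intro W u hu
    have := mvfderiv_symm_apply hy hu W
    rwa [← hx] at this
  set η : E → E →L[ℝ] ℝ := fun y : E ↦ ((α ((extChartAt 𝓘(ℝ, E) x).symm y)).comp
        (mfderiv 𝓘(ℝ, E) 𝓘(ℝ, E) (extChartAt 𝓘(ℝ, E) x).symm y) : E →L[ℝ] ℝ) with hηdef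
  have happ : ∀ W : Π y : M, TangentSpace 𝓘(ℝ, E) y, ∀ y ∈ (extChartAt 𝓘(ℝ, E) x).target,
      α ((extChartAt 𝓘(ℝ, E) x).symm y) (W ((extChartAt 𝓘(ℝ, E) x).symm y)) =
        η y (chartField x W y) := by
    intro W y hy'
    rw [← mfderiv_extChartAt_symm_apply_chartField W hy']
    rfl
  -- Product rule in the chart: the derivatives of `η` make up `dα`, and those of the fields combine
  -- into `α` of the bracket.
  have h2 : ∀ {W : Π y : M, TangentSpace 𝓘(ℝ, E) y}, SmoothField W → ∀ v,
      fderiv ℝ ((fun y ↦ α y (W y)) ∘ (extChartAt 𝓘(ℝ, E) x).symm) z v =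
      fderiv ℝ η z v (chartField x W z) + η z (fderiv ℝ (chartField x W) z v) := by
    intro W hW v
    have e : (fun y ↦ α y (W y)) ∘ (extChartAt 𝓘(ℝ, E) x).symm =ᶠ[𝓝 z]
        fun y ↦ η y (chartField x W y) := by
      filter_upwards [extChartAt_target_mem_nhds_of_mem hy] with y hy'
      exact happ W y hy'
    rw [e.fderiv_eq, fderiv_clm_apply hη]
    · simp [add_comm]
    · exact (contDiffAt_chartField hy (hW _)).differentiableAt (by simp)
  have h3 := happ (VectorField.mlieBracket 𝓘(ℝ, E) X Y) z hy
  rw [← hx, chartField_mlieBracket hy hX hY, VectorField.lieBracket, map_sub] at h3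
  rw [key X (hα.contMDiff_apply hY), key Y (hα.contMDiff_apply hX), h2 hX, h2 hY, h3]
  have hd : DifferentiableAt ℝ (fun y : E ↦
      ContinuousAlternatingMap.ofSubsingleton ℝ E ℝ (0 : Fin 1) (η y)) z :=
    (ContinuousAlternatingMap.ofSubsingletonLIE (𝕜 := ℝ) (E := E) (F := ℝ)
      (0 : Fin 1)).differentiableAt.comp z hη
  have e := extDeriv_apply hd ![chartField x X z, chartField x Y z]
  have e2 : (mfderiv 𝓘(ℝ, E) 𝓘(ℝ, E) (extChartAt 𝓘(ℝ, E) x) x : E → E) ∘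
      (![X x, Y x] : Fin 2 → E) = ![chartField x X z, chartField x Y z] := by
    ext i
    fin_cases i
    · exact hXx
    · exact hYx
  have e3 : ∀ v w : E, fderiv ℝ (fun y ↦ η y v) z w = fderiv ℝ η z w v := by
    intro v w
    rw [fderiv_clm_apply hη (differentiableAt_const v)]
    simp
  refine Eq.trans (congrArg (extDeriv (fun y : E ↦
      ContinuousAlternatingMap.ofSubsingleton ℝ E ℝ (0 : Fin 1) (η y)) z) e2) (e.trans ?_)
  simp [Fin.sum_univ_two, Fin.removeNth, e3]
  ring

end Charts

/-! ### Reeb vector fields -/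

section Reeb

open VectorField

variable {E : Type*} [NormedAddCommGroup E] [NormedSpace ℝ E] [FiniteDimensional ℝ E]
  {M : Type*} [TopologicalSpace M] [ChartedSpace E M] [IsManifold 𝓘(ℝ, E) ∞ M]

/-- The chart used by `extDerivOne` varies with the point, so smoothness is read off the invariant
formula instead. -/
theorem SmoothOneForm.contMDiff_extDerivOne {α : Π x : M, TangentSpace 𝓘(ℝ, E) x →L[ℝ] ℝ}
    (hα : SmoothOneForm α) {X Y : Π x : M, TangentSpace 𝓘(ℝ, E) x} (hX : SmoothField X)
    (hY : SmoothField Y) :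
    ContMDiff 𝓘(ℝ, E) 𝓘(ℝ, ℝ) ∞ (fun x ↦ extDerivOne α x ![X x, Y x]) := by
  have : CompleteSpace E := FiniteDimensional.complete ℝ E
  simp only [extDerivOne_apply hα hX hY]
  exact ((hX.contMDiff_mvfderiv (hα.contMDiff_apply hY)).sub
    (hY.contMDiff_mvfderiv (hα.contMDiff_apply hX))).sub (hα.contMDiff_apply (hX.mlieBracket hY))

variable {α : Fin 2 → Π x : M, TangentSpace 𝓘(ℝ, E) x →L[ℝ] ℝ}
  {Z : Fin 2 → Π x : M, TangentSpace 𝓘(ℝ, E) x}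

/-- `L_{Z_j} α_i = 0`. -/
theorem IsReebPair.mvfderiv_apply (hR : IsReebPair α Z) (hα : ∀ i, SmoothOneForm (α i))
    (i j : Fin 2) {W : Π x : M, TangentSpace 𝓘(ℝ, E) x} (hW : SmoothField W) (x : M) :
    mvfderiv 𝓘(ℝ, E) (fun y ↦ α i y (W y)) x (Z j x) =
      α i x (mlieBracket 𝓘(ℝ, E) (Z j) W x) := by
  have h := extDerivOne_apply (hα i) (hR.smooth j) hW x
  simp only [hR.contract_eq_zero, hR.apply_eq, mvfderiv_const] at h
  rw [zero_apply, sub_zero] at h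
  linarith

/-- `L_{Z_j} dα_i = 0`. -/
theorem IsReebPair.mvfderiv_extDerivOne (hR : IsReebPair α Z) (hα : ∀ i, SmoothOneForm (α i))
    (i j : Fin 2) {A B : Π x : M, TangentSpace 𝓘(ℝ, E) x} (hA : SmoothField A)
    (hB : SmoothField B) (x : M) :
    mvfderiv 𝓘(ℝ, E) (fun y ↦ extDerivOne (α i) y ![A y, B y]) x (Z j x) =
      extDerivOne (α i) x ![mlieBracket 𝓘(ℝ, E) (Z j) A x, B x] +
        extDerivOne (α i) x ![A x, mlieBracket 𝓘(ℝ, E) (Z j) B x] := by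
  have : CompleteSpace E := FiniteDimensional.complete ℝ E
  have hZ := hR.smooth j
  have hZA := hZ.mlieBracket hA
  have hZB := hZ.mlieBracket hB
  have hαA := (hα i).contMDiff_apply hA
  have hαB := (hα i).contMDiff_apply hB
  have hd : ∀ {f : M → ℝ}, ContMDiff 𝓘(ℝ, E) 𝓘(ℝ, ℝ) ∞ f →
      MDifferentiableAt 𝓘(ℝ, E) 𝓘(ℝ, ℝ) f x := fun hf ↦ (hf x).mdifferentiableAt (by simp)
  have h1 := hA.contMDiff_mvfderiv hαB
  have h2 := hB.contMDiff_mvfderiv hαA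
  have h3 := (hα i).contMDiff_apply (hA.mlieBracket hB)
  have e1 : mvfderiv 𝓘(ℝ, E) (fun y ↦ extDerivOne (α i) y ![A y, B y]) x =
      mvfderiv 𝓘(ℝ, E) (fun y ↦ mvfderiv 𝓘(ℝ, E) (fun y ↦ α i y (B y)) y (A y)) x -
      mvfderiv 𝓘(ℝ, E) (fun y ↦ mvfderiv 𝓘(ℝ, E) (fun y ↦ α i y (A y)) y (B y)) x -
      mvfderiv 𝓘(ℝ, E) (fun y ↦ α i y (mlieBracket 𝓘(ℝ, E) A B y)) x := by
    have hs1 := mvfderiv_sub (hd h1) (hd h2)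
    have hs2 := mvfderiv_sub (hd (h1.sub h2)) (hd h3)
    rw [← hs1]
    refine Eq.trans ?_ hs2
    congr 1
    ext y
    exact extDerivOne_apply (hα i) hA hB y
  -- The Jacobi identity splits `α([Z, [A, B]])` into the bracket terms of `dα([Z, A], B)` and
  -- `dα(A, [Z, B])`.
  have hjac := leibniz_identity_mlieBracket_apply (I := 𝓘(ℝ, E)) (x := x)
    ((hZ x).of_le (by simpa using ENat.LEInfty.out))
    ((hA x).of_le (by simpa using ENat.LEInfty.out))
    ((hB x).of_le (by simpa using ENat.LEInfty.out))
  have e4 := hR.mvfderiv_apply hα i j (hA.mlieBracket hB) x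
  rw [hjac, map_add] at e4
  rw [e1, extDerivOne_apply (hα i) hZA hB, extDerivOne_apply (hα i) hA hZB,
    sub_apply, sub_apply, e4, mvfderiv_mlieBracket hZ hA hαB, mvfderiv_mlieBracket hZ hB hαA]
  simp only [hR.mvfderiv_apply hα i j hB, hR.mvfderiv_apply hα i j hA]
  ring

/-- Differentiating the constants `α_l(Z_j)` and `dα_l(Z_j, W) = 0` along `Z_i` puts the bracket in
the kernel of every `α_l` and `dα_l`. -/
theorem IsReebPair.mlieBracket_eq_zero {h k : ℕ} (hR : IsReebPair α Z)
    (hα : IsContactPair h k (α 0) (α 1)) [T2Space M] (i j : Fin 2) (x : M) :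
    mlieBracket 𝓘(ℝ, E) (Z i) (Z j) x = 0 := by
  have hs : ∀ i, SmoothOneForm (α i) := by
    intro i
    fin_cases i
    exacts [hα.smooth₁, hα.smooth₂]
  refine hα.eq_zero (fun l ↦ ?_) (fun l w ↦ ?_)
  · rw [← hR.mvfderiv_apply hs l i (hR.smooth j)]
    simp only [hR.apply_eq, mvfderiv_const]
    rfl
  · obtain ⟨W, hW, rfl⟩ := exists_smoothField_eq w
    have e := hR.mvfderiv_extDerivOne hs l i (hR.smooth j) hW x
    simp only [hR.contract_eq_zero, mvfderiv_const] at e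
    rw [zero_apply, add_zero] at e
    exact e.symm

end Reeb

/-! ### Compatible and associated metrics -/

section MetricLemmas

open VectorField

variable {E : Type*} [NormedAddCommGroup E] [NormedSpace ℝ E]
  {M : Type*} [TopologicalSpace M] [ChartedSpace E M] [IsManifold 𝓘(ℝ, E) ∞ M]
  {h k : ℕ} {α : Fin 2 → Π x : M, TangentSpace 𝓘(ℝ, E) x →L[ℝ] ℝ}
  {Z : Fin 2 → Π x : M, TangentSpace 𝓘(ℝ, E) x}
  {φ : Π x : M, TangentSpace 𝓘(ℝ, E) x →L[ℝ] TangentSpace 𝓘(ℝ, E) x}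
  {g : Metric E M}

theorem IsContactPairStructure.smoothOneForm (hS : IsContactPairStructure h k α Z φ)
    (i : Fin 2) : SmoothOneForm (α i) := by
  fin_cases i
  exacts [hS.contactPair.smooth₁, hS.contactPair.smooth₂]

theorem Metric.contMDiff_inner (g : Metric E M) {X Y : Π x : M, TangentSpace 𝓘(ℝ, E) x}
    (hX : SmoothField X) (hY : SmoothField Y) :
    ContMDiff 𝓘(ℝ, E) 𝓘(ℝ, ℝ) ∞ (fun x ↦ g.inner x (X x) (Y x)) := by
  intro x
  have h := ContMDiffAt.clm_bundle_apply₂ (E₃ := Bundle.Trivial M ℝ) (b := id) (g.contMDiff x)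
    (hX x) (hY x)
  simpa using (Bundle.contMDiffAt_section _).1 h

theorem Metric.eq_zero_of_inner_self (g : Metric E M) {x : M} {v : TangentSpace 𝓘(ℝ, E) x}
    (hv : g.inner x v v = 0) : v = 0 := by
  by_contra h0
  exact (g.pos x v h0).ne' hv

/-- In the compatibility identity at `(Z_i, w)` the left side vanishes because `φ Z_i = 0`. -/
theorem IsCompatible.inner_reeb (hS : IsContactPairStructure h k α Z φ)
    (hg : IsCompatible α φ g) (i : Fin 2) (x : M) (w : TangentSpace 𝓘(ℝ, E) x) :
    g.inner x (Z i x) w = α i x w := by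
  have h := hg x (Z i x) w
  rw [hS.map_reeb, map_zero, zero_apply, hS.reeb.apply_eq, hS.reeb.apply_eq] at h
  fin_cases i <;> simp at h ⊢ <;> linarith

theorem IsCompatible.inner_reeb_reeb (hS : IsContactPairStructure h k α Z φ)
    (hg : IsCompatible α φ g) (i j : Fin 2) (x : M) :
    g.inner x (Z i x) (Z j x) = if i = j then 1 else 0 := by
  rw [hg.inner_reeb hS, hS.reeb.apply_eq]

theorem IsAssociated.inner_phi (ha : IsAssociated α Z φ g) (x : M)
    (u w : TangentSpace 𝓘(ℝ, E) x) :
    g.inner x u (φ x w) = extDerivOne (α 0) x ![u, w] + extDerivOne (α 1) x ![u, w] :=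
  ha.1 x u w

variable [FiniteDimensional ℝ E]

/-- `∇_{Z_i} Z_j = 0`. -/
theorem IsLeviCivita.cov_reeb [T2Space M] (hS : IsContactPairStructure h k α Z φ)
    (hg : IsCompatible α φ g) {cov : Connection E M} (hc : IsLeviCivita g cov) (i j : Fin 2)
    (x : M) : cov (Z j) x (Z i x) = 0 := by
  have hZ := hS.reeb.smooth
  have htor : ∀ {X Y : Π x : M, TangentSpace 𝓘(ℝ, E) x} {x : M},
      MDifferentiableAt 𝓘(ℝ, E) (𝓘(ℝ, E).prod 𝓘(ℝ, E))
        (fun x ↦ (TotalSpace.mk' E x (X x) : TangentBundle 𝓘(ℝ, E) M)) x →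
      MDifferentiableAt 𝓘(ℝ, E) (𝓘(ℝ, E).prod 𝓘(ℝ, E))
        (fun x ↦ (TotalSpace.mk' E x (Y x) : TangentBundle 𝓘(ℝ, E) M)) x →
      cov Y x (X x) - cov X x (Y x) = mlieBracket 𝓘(ℝ, E) X Y x :=
    (CovariantDerivative.torsion_eq_zero_iff cov).1 hc.torsion_eq_zero
  -- Here `Z_i(g(Z_j, X)) = Z_i(α_j(X)) = α_j([Z_i, X])`, and zero torsion expands the bracket.
  have key : ∀ (i j : Fin 2) {X : Π x : M, TangentSpace 𝓘(ℝ, E) x}, SmoothField X →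
      g.inner x (cov (Z j) x (Z i x)) (X x) = - g.inner x (Z j x) (cov (Z i) x (X x)) := by
    intro i j X hX
    have h1 := hc.metric x (Z j) X ((hZ j).mdifferentiableAt x) (hX.mdifferentiableAt x) (Z i x)
    simp only [hg.inner_reeb hS] at h1
    rw [hS.reeb.mvfderiv_apply hS.smoothOneForm j i hX,
      ← htor ((hZ i).mdifferentiableAt x) (hX.mdifferentiableAt x), map_sub] at h1
    rw [hg.inner_reeb hS]
    linarith
  -- Testing against an extension of the vector itself reduces the claim to positivity of `g`.
  obtain ⟨X, hX, hXx⟩ := exists_smoothField_eq (cov (Z j) x (Z i x))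
  have h0 : cov (Z j) x (Z i x) = cov (Z i) x (Z j x) := by
    have := htor ((hZ i).mdifferentiableAt x) ((hZ j).mdifferentiableAt x)
    rwa [hS.reeb.mlieBracket_eq_zero hS.contactPair, sub_eq_zero] at this
  have h1 := key i j hX
  have h2 := key j i hX
  have h3 := hc.metric x (Z i) (Z j) ((hZ i).mdifferentiableAt x) ((hZ j).mdifferentiableAt x)
    (X x)
  simp only [hg.inner_reeb_reeb hS, mvfderiv_const] at h3
  rw [zero_apply, g.symm x (cov (Z i) x (X x))] at h3
  rw [← h0] at h2
  apply g.eq_zero_of_inner_self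
  rw [hXx] at h1 h2 h3
  linarith

theorem IsAssociated.lieDerivEndoVanishes_iff (hS : IsContactPairStructure h k α Z φ)
    (hg : IsCompatible α φ g) (ha : IsAssociated α Z φ g) (i : Fin 2) :
    LieDerivEndoVanishes (Z i) φ ↔ IsKilling g (Z i) := by
  have : CompleteSpace E := FiniteDimensional.complete ℝ E
  have hZ := hS.reeb.smooth i
  have hα := hS.smoothOneForm
  have hd : ∀ {f : M → ℝ} {x : M}, ContMDiff 𝓘(ℝ, E) 𝓘(ℝ, ℝ) ∞ f →
      MDifferentiableAt 𝓘(ℝ, E) 𝓘(ℝ, ℝ) f x := fun hf ↦ (hf _).mdifferentiableAt (by simp)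
  -- Invariance of `dα_0 + dα_1` under `Z_i`, written through the associated metric.
  have hinv : ∀ {A B : Π x : M, TangentSpace 𝓘(ℝ, E) x}, SmoothField A → SmoothField B → ∀ x,
      mvfderiv 𝓘(ℝ, E) (fun y ↦ g.inner y (A y) (φ y (B y))) x (Z i x) =
        g.inner x (mlieBracket 𝓘(ℝ, E) (Z i) A x) (φ x (B x)) +
        g.inner x (A x) (φ x (mlieBracket 𝓘(ℝ, E) (Z i) B x)) := by
    intro A B hA hB x
    have h0 := (hα 0).contMDiff_extDerivOne hA hB
    have h1 := (hα 1).contMDiff_extDerivOne hA hB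
    have := mvfderiv_add (x := x) (hd h0) (hd h1)
    simp only [ha.inner_phi]
    refine (congr($this (Z i x))).trans ?_
    rw [add_apply, hS.reeb.mvfderiv_extDerivOne hα 0 i hA hB,
      hS.reeb.mvfderiv_extDerivOne hα 1 i hA hB]
    ring
  constructor
  · intro hL X Y hX hY x
    have hφX := hS.smooth.smoothField_apply hX
    -- Compatibility splits `g` into a part to which `hinv` applies, with `A = φ X` and `B = Y`, and
    -- products of the invariant forms `α_l`.
    have e1 : ∀ y, g.inner y (X y) (Y y) = g.inner y (φ y (X y)) (φ y (Y y)) +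
        (α 0 y (X y) * α 0 y (Y y) + α 1 y (X y) * α 1 y (Y y)) := fun y ↦ by
      rw [hg]; ring
    have hXα := fun l ↦ (hα l).contMDiff_apply hX
    have hYα := fun l ↦ (hα l).contMDiff_apply hY
    have e2 : mvfderiv 𝓘(ℝ, E) (fun y ↦ g.inner y (X y) (Y y)) x (Z i x) =
        mvfderiv 𝓘(ℝ, E) (fun y ↦ g.inner y (φ y (X y)) (φ y (Y y))) x (Z i x) +
        ((α 0 x (X x) * mvfderiv 𝓘(ℝ, E) (fun y ↦ α 0 y (Y y)) x (Z i x) +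
          mvfderiv 𝓘(ℝ, E) (fun y ↦ α 0 y (X y)) x (Z i x) * α 0 x (Y x)) +
        (α 1 x (X x) * mvfderiv 𝓘(ℝ, E) (fun y ↦ α 1 y (Y y)) x (Z i x) +
          mvfderiv 𝓘(ℝ, E) (fun y ↦ α 1 y (X y)) x (Z i x) * α 1 x (Y x))) := by
      have hm := fun l ↦ mvfderiv_mul (hd (x := x) (hXα l)) (hd (x := x) (hYα l))
      have ha1 := mvfderiv_add (hd (x := x) ((hXα 0).mul (hYα 0)))
        (hd (x := x) ((hXα 1).mul (hYα 1)))
      have ha2 := mvfderiv_add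
        (hd (x := x) (g.contMDiff_inner hφX (hS.smooth.smoothField_apply hY)))
        (hd (x := x) (((hXα 0).mul (hYα 0)).add ((hXα 1).mul (hYα 1))))
      simp only [e1]
      refine (congr($ha2 (Z i x))).trans ?_
      rw [add_apply, ha1, add_apply]
      erw [hm 0, hm 1]
      simp
      ring
    have e3 : mlieBracket 𝓘(ℝ, E) (Z i) (fun y ↦ φ y (X y)) x =
        φ x (mlieBracket 𝓘(ℝ, E) (Z i) X x) := sub_eq_zero.1 (hL X hX x)
    rw [lieDerivMetric, e2, hinv hφX hY, e3, hg, hg, hS.reeb.mvfderiv_apply hα 0 i hX,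
      hS.reeb.mvfderiv_apply hα 1 i hX, hS.reeb.mvfderiv_apply hα 0 i hY,
      hS.reeb.mvfderiv_apply hα 1 i hY]
    ring
  · intro hK Y hY x
    have hφY := hS.smooth.smoothField_apply hY
    -- For Killing `Z_i`, `hinv` gives `g(X, (L φ) Y) = 0` for every `X`; the choice `X = (L φ) Y`
    -- forces it to vanish.
    set X : Π x : M, TangentSpace 𝓘(ℝ, E) x := fun x ↦ lieDerivEndo (Z i) φ Y x with hXdef
    have hX : SmoothField X :=
      ContMDiff.sub_section (hZ.mlieBracket hφY)
        (hS.smooth.smoothField_apply (hZ.mlieBracket hY))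
    have e := hK X _ hX hφY x
    rw [lieDerivMetric, hinv hX hY] at e
    apply g.eq_zero_of_inner_self
    change g.inner x (X x) (mlieBracket 𝓘(ℝ, E) (Z i) (fun y ↦ φ y (Y y)) x -
      φ x (mlieBracket 𝓘(ℝ, E) (Z i) Y x)) = 0
    rw [map_sub]
    linarith

end MetricLemmas

/-! ### Coordinate expressions of a connection -/

section OneJet

variable {E : Type*} [NormedAddCommGroup E] [NormedSpace ℝ E]
  {M : Type*} [TopologicalSpace M] [ChartedSpace E M]

/-- The components in the preferred chart at `x` of the vector field `σ`, as a function on `M`. -/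
def chartComponents (x : M) (σ : Π y : M, TangentSpace 𝓘(ℝ, E) y) (z : M) : E :=
  mfderiv 𝓘(ℝ, E) 𝓘(ℝ, E) (extChartAt 𝓘(ℝ, E) x) z (σ z)

theorem chartComponents_add (x : M) (σ τ : Π y : M, TangentSpace 𝓘(ℝ, E) y) :
    chartComponents x (σ + τ) = chartComponents x σ + chartComponents x τ :=
  funext fun _ ↦ map_add _ _ _

theorem chartComponents_smul (x : M) (f : M → ℝ) (σ : Π y : M, TangentSpace 𝓘(ℝ, E) y) :
    chartComponents x (f • σ) = f • chartComponents x σ :=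
  funext fun _ ↦ map_smul _ _ _

theorem coordField_zero (x : M) : coordField x (0 : TangentSpace 𝓘(ℝ, E) x) = 0 := by
  funext y
  exact congrArg _ (map_zero (mfderiv 𝓘(ℝ, E) 𝓘(ℝ, E) (extChartAt 𝓘(ℝ, E) x) x)) |>.trans
    (map_zero (mfderiv 𝓘(ℝ, E) 𝓘(ℝ, E) (extChartAt 𝓘(ℝ, E) x) y).inverse)

variable [IsManifold 𝓘(ℝ, E) ∞ M]

/-- The tangent space at `x` is identified with `E` by the preferred chart at `x`, whose derivative
there is the identity. -/
theorem chartComponents_self (x : M) (σ : Π y : M, TangentSpace 𝓘(ℝ, E) y) :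
    chartComponents x σ x = σ x := by
  have : IsManifold 𝓘(ℝ, E) 1 M := IsManifold.of_le (n := ∞) (by simp)
  exact congr($(mfderiv_extChartAt_self (I := 𝓘(ℝ, E)) (x := x)) (σ x))

theorem mdifferentiableAt_chartComponents {x : M} {σ : Π y : M, TangentSpace 𝓘(ℝ, E) y}
    (hσ : MDifferentiableAt 𝓘(ℝ, E) (𝓘(ℝ, E).prod 𝓘(ℝ, E))
      (fun x ↦ (TotalSpace.mk' E x (σ x) : TangentBundle 𝓘(ℝ, E) M)) x) :
    MDifferentiableAt 𝓘(ℝ, E) 𝓘(ℝ, E) (chartComponents x σ) x := by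
  have : IsManifold 𝓘(ℝ, E) 1 M := IsManifold.of_le (n := ∞) (by simp)
  refine ((mdifferentiableAt_section _ _).1 hσ).congr_of_eventuallyEq ?_
  filter_upwards [(chartAt E x).open_source.mem_nhds (mem_chart_source E x)] with z hz
  rw [chartComponents, ← TangentBundle.continuousLinearMapAt_trivializationAt hz]
  exact Trivialization.continuousLinearMapAt_apply_of_mem (R := ℝ) (b := z)
    (trivializationAt E (TangentSpace 𝓘(ℝ, E)) x) hz (σ z)

theorem mdifferentiableAt_coordField [CompleteSpace E] (x : M) (w : TangentSpace 𝓘(ℝ, E) x) :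
    MDifferentiableAt 𝓘(ℝ, E) (𝓘(ℝ, E).prod 𝓘(ℝ, E))
      (fun y ↦ (TotalSpace.mk' E y (coordField x w y) : TangentBundle 𝓘(ℝ, E) M)) x :=
  (contMDiffAt_mpullback_extChartAt (mem_extChartAt_source x) _).mdifferentiableAt (by simp)

theorem chartComponents_coordField (x : M) (w : TangentSpace 𝓘(ℝ, E) x) {z : M}
    (hz : z ∈ (extChartAt 𝓘(ℝ, E) x).source) : chartComponents x (coordField x w) z = w := by
  have : IsManifold 𝓘(ℝ, E) 1 M := IsManifold.of_le (n := ∞) (by simp)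
  refine ((isInvertible_mfderiv_extChartAt hz).self_apply_inverse _).trans ?_
  exact congr($(mfderiv_extChartAt_self (I := 𝓘(ℝ, E)) (x := x)) w)

theorem coordField_self (x : M) (w : TangentSpace 𝓘(ℝ, E) x) : coordField x w x = w :=
  (chartComponents_self x (coordField x w)).symm.trans
    (chartComponents_coordField x w (mem_extChartAt_source x))

/-- The derivative at `x` of the components of `σ` in the preferred chart at `x`. -/
def chartDeriv (x : M) (σ : Π y : M, TangentSpace 𝓘(ℝ, E) y) :
    TangentSpace 𝓘(ℝ, E) x →L[ℝ] TangentSpace 𝓘(ℝ, E) x :=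
  mvfderiv 𝓘(ℝ, E) (chartComponents x σ) x

theorem chartDeriv_add {x : M} {σ τ : Π y : M, TangentSpace 𝓘(ℝ, E) y}
    (hσ : MDifferentiableAt 𝓘(ℝ, E) (𝓘(ℝ, E).prod 𝓘(ℝ, E))
      (fun x ↦ (TotalSpace.mk' E x (σ x) : TangentBundle 𝓘(ℝ, E) M)) x)
    (hτ : MDifferentiableAt 𝓘(ℝ, E) (𝓘(ℝ, E).prod 𝓘(ℝ, E))
      (fun x ↦ (TotalSpace.mk' E x (τ x) : TangentBundle 𝓘(ℝ, E) M)) x) :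
    chartDeriv x (σ + τ) = chartDeriv x σ + chartDeriv x τ := by
  rw [chartDeriv, chartComponents_add]
  exact mvfderiv_add (mdifferentiableAt_chartComponents hσ) (mdifferentiableAt_chartComponents hτ)

theorem chartDeriv_smul {x : M} {σ : Π y : M, TangentSpace 𝓘(ℝ, E) y} {f : M → ℝ}
    (hf : MDifferentiableAt 𝓘(ℝ, E) 𝓘(ℝ, ℝ) f x)
    (hσ : MDifferentiableAt 𝓘(ℝ, E) (𝓘(ℝ, E).prod 𝓘(ℝ, E))
      (fun x ↦ (TotalSpace.mk' E x (σ x) : TangentBundle 𝓘(ℝ, E) M)) x) :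
    chartDeriv x (f • σ) =
      f x • chartDeriv x σ + (mvfderiv 𝓘(ℝ, E) f x).smulRight (σ x) := by
  rw [chartDeriv, chartComponents_smul]
  refine (mvfderiv_smul hf (mdifferentiableAt_chartComponents hσ)).trans ?_
  exact congrArg (fun v : TangentSpace 𝓘(ℝ, E) x ↦
    f x • chartDeriv x σ + (mvfderiv 𝓘(ℝ, E) f x).smulRight v) (chartComponents_self x σ)

theorem chartDeriv_coordField (x : M) (w : TangentSpace 𝓘(ℝ, E) x) :
    chartDeriv x (coordField x w) = 0 := by
  have : chartComponents x (coordField x w) =ᶠ[𝓝 x] fun _ ↦ (show E from w) := by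
    filter_upwards [extChartAt_source_mem_nhds (I := 𝓘(ℝ, E)) x] with z hz
    exact chartComponents_coordField x w hz
  exact (this.mfderiv_eq (I := 𝓘(ℝ, E)) (I' := 𝓘(ℝ, E))).trans mfderiv_const

/-- The coordinate formula `∇_u σ = dσ^k(u) ∂_k + σ^j ∇_u ∂_j`. -/
theorem Connection.apply_eq [FiniteDimensional ℝ E] (cov : Connection E M) {x : M}
    {σ : Π y : M, TangentSpace 𝓘(ℝ, E) y}
    (hσ : MDifferentiableAt 𝓘(ℝ, E) (𝓘(ℝ, E).prod 𝓘(ℝ, E))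
      (fun x ↦ (TotalSpace.mk' E x (σ x) : TangentBundle 𝓘(ℝ, E) M)) x)
    (u : TangentSpace 𝓘(ℝ, E) x) :
    cov σ x u = chartDeriv x σ u + cov (coordField x (σ x)) x u := by
  have : CompleteSpace E := FiniteDimensional.complete ℝ E
  have : IsManifold 𝓘(ℝ, E) 1 M := IsManifold.of_le (n := ∞) (by simp)
  -- The Leibniz terms cancel in the difference, so it depends only on `σ x` and can be evaluated on
  -- `coordField`, where `chartDeriv` is zero.
  have ht : TensorialAt 𝓘(ℝ, E) E (fun τ ↦ cov τ x u - chartDeriv x τ u) x := by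
    constructor
    · intro f τ hf hτ
      rw [cov.isCovariantDerivativeOnUniv.leibniz hτ hf, chartDeriv_smul hf hτ]
      simp [smul_sub]
    · intro τ τ' hτ hτ'
      rw [cov.isCovariantDerivativeOnUniv.add hτ hτ', chartDeriv_add hτ hτ']
      simp only [add_apply]
      abel
  have h1 := ht.pointwise hσ (mdifferentiableAt_coordField x (σ x)) (coordField_self x _).symm
  rwa [chartDeriv_coordField, zero_apply, sub_zero, sub_eq_iff_eq_add'] at h1

/-- The covariant derivative of a vector field which vanishes along a map. -/
theorem Connection.apply_mfderiv_eq_zero [FiniteDimensional ℝ E] (cov : Connection E M)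
    {F H N : Type*} [NormedAddCommGroup F] [NormedSpace ℝ F] [TopologicalSpace H]
    {I : ModelWithCorners ℝ F H} [TopologicalSpace N] [ChartedSpace H N] {f : N → M} {q : N}
    (hf : MDifferentiableAt I 𝓘(ℝ, E) f q) {σ : Π y : M, TangentSpace 𝓘(ℝ, E) y}
    (hσ : MDifferentiableAt 𝓘(ℝ, E) (𝓘(ℝ, E).prod 𝓘(ℝ, E))
      (fun x ↦ (TotalSpace.mk' E x (σ x) : TangentBundle 𝓘(ℝ, E) M)) (f q))
    (h0 : ∀ᶠ q' in 𝓝 q, σ (f q') = 0) (w : TangentSpace I q) :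
    cov σ (f q) (mfderiv I 𝓘(ℝ, E) f q w) = 0 := by
  rw [cov.apply_eq hσ, h0.self_of_nhds, coordField_zero, cov.zero]
  -- Only the derivative of the components is left; by the chain rule it kills the image of `df`.
  have h1 : chartComponents (f q) σ ∘ f =ᶠ[𝓝 q] fun _ ↦ 0 := by
    filter_upwards [h0] with q' hq'
    simp only [Function.comp_apply, chartComponents, hq', map_zero]
    rfl
  have h2 := (h1.mfderiv_eq (I := I) (I' := 𝓘(ℝ, E))).trans mfderiv_const
  rw [mfderiv_comp q (mdifferentiableAt_chartComponents hσ) hf] at h2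
  refine (add_zero _).trans ?_
  exact congr($h2 w)

end OneJet

/-! ### Integral curves -/

section IntegralCurves

variable {E : Type*} [NormedAddCommGroup E] [NormedSpace ℝ E]
  {M : Type*} [TopologicalSpace M] [ChartedSpace E M]

theorem velocity_eq {γ : ℝ → M} {X : Π x : M, TangentSpace 𝓘(ℝ, E) x} {s : Set ℝ}
    (hs : IsOpen s) (hγ : IsMIntegralCurveOn γ X s) {t : ℝ} (ht : t ∈ s) :
    velocity γ t = X (γ t) := by
  rw [velocity, ((hγ t ht).hasMFDerivAt (hs.mem_nhds ht)).mfderiv]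
  exact one_smul (M := ℝ) (α := E) (X (γ t))

theorem hasDerivAt_comp_of_isMIntegralCurveOn {F : Type*} [NormedAddCommGroup F]
    [NormedSpace ℝ F] {γ : ℝ → M} {X : Π x : M, TangentSpace 𝓘(ℝ, E) x} {s : Set ℝ}
    (hs : IsOpen s) (hγ : IsMIntegralCurveOn γ X s) {t : ℝ} (ht : t ∈ s) {f : M → F}
    (hf : MDifferentiableAt 𝓘(ℝ, E) 𝓘(ℝ, F) f (γ t)) :
    HasDerivAt (f ∘ γ) (mvfderiv 𝓘(ℝ, E) f (γ t) (X (γ t))) t := by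
  have h2 : HasFDerivAt (f ∘ γ) ((mvfderiv 𝓘(ℝ, E) f (γ t)).comp
      ((1 : ℝ →L[ℝ] ℝ).smulRight (X (γ t)))) t :=
    hasMFDerivAt_iff_hasFDerivAt.1
      (hf.hasMFDerivAt.comp t ((hγ t ht).hasMFDerivAt (hs.mem_nhds ht)))
  exact h2.hasDerivAt.congr_deriv
    (congrArg (mvfderiv 𝓘(ℝ, E) f (γ t)) (one_smul (M := ℝ) (α := E) (X (γ t))))

variable [IsManifold 𝓘(ℝ, E) ∞ M]

theorem hasDerivAt_extChartAt_comp {γ : ℝ → M} {X : Π x : M, TangentSpace 𝓘(ℝ, E) x} {s : Set ℝ}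
    (hs : IsOpen s) (hγ : IsMIntegralCurveOn γ X s) {t : ℝ} (ht : t ∈ s) {x : M}
    (hx : γ t ∈ (extChartAt 𝓘(ℝ, E) x).source) :
    HasDerivAt (extChartAt 𝓘(ℝ, E) x ∘ γ) (chartField x X (extChartAt 𝓘(ℝ, E) x (γ t))) t := by
  have : IsManifold 𝓘(ℝ, E) 1 M := IsManifold.of_le (n := ∞) (by simp)
  exact (hasDerivAt_comp_of_isMIntegralCurveOn hs hγ ht
    (mdifferentiableAt_extChartAt (by rwa [extChartAt_source] at hx))).congr_deriv
    (mfderiv_extChartAt_apply X hx)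

/-- In a chart an integral curve solves a total differential equation with parameter space `ℝ`, so
the bootstrapping result applies. -/
theorem contMDiffOn_of_isMIntegralCurveOn [CompleteSpace E] {γ : ℝ → M}
    {X : Π x : M, TangentSpace 𝓘(ℝ, E) x} (hX : SmoothField X) {s : Set ℝ}
    (hs : IsOpen s) (hγ : IsMIntegralCurveOn γ X s) :
    ContMDiffOn 𝓘(ℝ, ℝ) 𝓘(ℝ, E) ∞ γ s := by
  intro t ht
  apply ContMDiffAt.contMDiffWithinAt
  set χ := extChartAt 𝓘(ℝ, E) (γ t) with hχ
  have hc : ContinuousOn γ s := fun r hr ↦ (hγ r hr).continuousWithinAt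
  have ho : IsOpen (s ∩ γ ⁻¹' χ.source) :=
    hc.isOpen_inter_preimage hs (isOpen_extChartAt_source _)
  have hto : t ∈ s ∩ γ ⁻¹' χ.source := ⟨ht, mem_extChartAt_source _⟩
  have hA : ContDiffOn ℝ ∞ (fun y : E ↦
      ContinuousLinearMap.toSpanSingletonLIE ℝ E (chartField (γ t) X y))
      χ.target := fun y hy ↦
    ((ContinuousLinearMap.toSpanSingletonLIE ℝ E).contDiff.contDiffAt.comp y
      (contDiffAt_chartField hy (hX _))).contDiffWithinAt
  have h1 := contDiffOn_of_hasFDerivAt hA (F := χ ∘ γ) ho fun r hr ↦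
    ⟨χ.map_source hr.2, hasDerivAt_extChartAt_comp hs hγ hr.1 hr.2⟩
  have h2 := contMDiffAt_iff_contDiffAt.2 (h1.contDiffAt (ho.mem_nhds hto))
  refine ((contMDiffAt_extChartAt_symm (mem_extChartAt_target (γ t))).comp t h2).congr_of_eventuallyEq
    ?_
  filter_upwards [ho.mem_nhds hto] with r hr
  exact (χ.left_inv hr.2).symm

theorem covDerivAlong_eq (cov : Connection E M) (γ : ℝ → M)
    (V : Π t : ℝ, TangentSpace 𝓘(ℝ, E) (γ t)) {t : ℝ} {v : TangentSpace 𝓘(ℝ, E) (γ t)}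
    (hv : HasDerivAt (fun r : ℝ ↦
      (mfderiv 𝓘(ℝ, E) 𝓘(ℝ, E) (extChartAt 𝓘(ℝ, E) (γ t)) (γ r) (V r) : E)) v t) :
    covDerivAlong cov γ V t = v + cov (coordField (γ t) (V t)) (γ t) (velocity γ t) := by
  have : IsManifold 𝓘(ℝ, E) 1 M := IsManifold.of_le (n := ∞) (by simp)
  have h4 : ∀ {L : E →L[ℝ] E} {w u : E}, L = .id ℝ E → w = u → L.inverse w = u := by
    rintro L w u rfl rfl
    rw [ContinuousLinearMap.inverse_id]
    rfl
  have h5 : (mfderiv 𝓘(ℝ, E) 𝓘(ℝ, E) (extChartAt 𝓘(ℝ, E) (γ t)) (γ t)).inverse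
      (deriv (fun r : ℝ ↦ (mfderiv 𝓘(ℝ, E) 𝓘(ℝ, E) (extChartAt 𝓘(ℝ, E) (γ t))
        (γ r) (V r) : E)) t) = v :=
    h4 (mfderiv_extChartAt_self (I := 𝓘(ℝ, E)) (x := γ t)) hv.deriv
  exact congrArg (· + cov (coordField (γ t) (V t)) (γ t) (velocity γ t)) h5

/-- Along the integral curves of `X` the covariant derivative of the velocity is `∇_X X`. -/
theorem covDerivAlong_velocity [FiniteDimensional ℝ E] (cov : Connection E M) {γ : ℝ → M}
    {X : Π x : M, TangentSpace 𝓘(ℝ, E) x} (hX : SmoothField X) {s : Set ℝ}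
    (hs : IsOpen s) (hγ : IsMIntegralCurveOn γ X s) {t : ℝ} (ht : t ∈ s) :
    covDerivAlong cov γ (velocity γ) t = cov X (γ t) (X (γ t)) := by
  have : IsManifold 𝓘(ℝ, E) 1 M := IsManifold.of_le (n := ∞) (by simp)
  have h1 : HasDerivAt (fun r ↦ chartComponents (γ t) X (γ r))
      (chartDeriv (γ t) X (X (γ t)) : E) t :=
    hasDerivAt_comp_of_isMIntegralCurveOn hs hγ ht
      (mdifferentiableAt_chartComponents (hX.mdifferentiableAt (γ t)))
  have h3 : (fun r : ℝ ↦ (mfderiv 𝓘(ℝ, E) 𝓘(ℝ, E) (extChartAt 𝓘(ℝ, E) (γ t)) (γ r)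
      (velocity γ r) : E)) =ᶠ[𝓝 t] fun r ↦ chartComponents (γ t) X (γ r) := by
    filter_upwards [hs.mem_nhds ht] with r hr
    rw [velocity_eq hs hγ hr]
    rfl
  rw [cov.apply_eq (hX.mdifferentiableAt _), covDerivAlong_eq cov γ (velocity γ)
    (h1.congr_of_eventuallyEq h3), velocity_eq hs hγ ht]

end IntegralCurves

/-! ### Integral surfaces of a pair of commuting vector fields -/

section Plaques

variable {E : Type*} [NormedAddCommGroup E] [NormedSpace ℝ E]
  {M : Type*} [TopologicalSpace M] [ChartedSpace E M]
  {Z : Fin 2 → Π x : M, TangentSpace 𝓘(ℝ, E) x}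

/-- The linear map `v ↦ v₀ Z₀ + v₁ Z₁`. -/
def linComb (Z : Fin 2 → Π x : M, TangentSpace 𝓘(ℝ, E) x) (x : M) :
    EuclideanSpace ℝ (Fin 2) →L[ℝ] TangentSpace 𝓘(ℝ, E) x :=
  (EuclideanSpace.proj (𝕜 := ℝ) (0 : Fin 2)).smulRight (Z 0 x) +
    (EuclideanSpace.proj (𝕜 := ℝ) (1 : Fin 2)).smulRight (Z 1 x)

theorem linComb_apply (x : M) (v : EuclideanSpace ℝ (Fin 2)) :
    linComb Z x v = v 0 • Z 0 x + v 1 • Z 1 x :=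
  rfl

theorem linComb_single (x : M) (i : Fin 2) :
    linComb Z x (EuclideanSpace.single i 1) = Z i x := by
  fin_cases i <;> simp [linComb_apply]

/-- `G` is on `s` an orbit map of the local action of `ℝ²` generated by `Z 0` and `Z 1`. -/
def IsPlaqueOn (Z : Fin 2 → Π x : M, TangentSpace 𝓘(ℝ, E) x) (G : EuclideanSpace ℝ (Fin 2) → M)
    (s : Set (EuclideanSpace ℝ (Fin 2))) : Prop :=
  ∀ v ∈ s, HasMFDerivAt 𝓘(ℝ, EuclideanSpace ℝ (Fin 2)) 𝓘(ℝ, E) G v (linComb Z (G v))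

theorem IsPlaqueOn.comp_const_add {G : EuclideanSpace ℝ (Fin 2) → M}
    {s : Set (EuclideanSpace ℝ (Fin 2))} (hG : IsPlaqueOn Z G s) (a : EuclideanSpace ℝ (Fin 2)) :
    IsPlaqueOn Z (fun v ↦ G (a + v)) {v | a + v ∈ s} := by
  intro v hv
  have h1 : HasMFDerivAt 𝓘(ℝ, EuclideanSpace ℝ (Fin 2)) 𝓘(ℝ, EuclideanSpace ℝ (Fin 2))
      (fun v ↦ a + v) v (.id ℝ (EuclideanSpace ℝ (Fin 2))) :=
    hasMFDerivAt_iff_hasFDerivAt.2 ((hasFDerivAt_id v).const_add a)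
  exact (hG _ hv).comp v h1

theorem IsPlaqueOn.isMIntegralCurveOn {G : EuclideanSpace ℝ (Fin 2) → M}
    {s : Set (EuclideanSpace ℝ (Fin 2))} (hG : IsPlaqueOn Z G s)
    (a w : EuclideanSpace ℝ (Fin 2)) :
    IsMIntegralCurveOn (fun t : ℝ ↦ G (a + t • w)) (fun x ↦ linComb Z x w)
      {t | a + t • w ∈ s} := by
  intro t ht
  have h1 : HasMFDerivAt 𝓘(ℝ, ℝ) 𝓘(ℝ, EuclideanSpace ℝ (Fin 2))
      (fun t : ℝ ↦ a + t • w) t ((1 : ℝ →L[ℝ] ℝ).smulRight w) :=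
    hasMFDerivAt_iff_hasFDerivAt.2 ((((1 : ℝ →L[ℝ] ℝ).smulRight w).hasFDerivAt).const_add a)
  have h2 := (hG _ ht).comp t h1
  have h3 : (linComb Z (G (a + t • w))).comp ((1 : ℝ →L[ℝ] ℝ).smulRight w) =
      (1 : ℝ →L[ℝ] ℝ).smulRight (linComb Z (G (a + t • w)) w) := by
    ext
    simp
  exact (h3 ▸ h2).hasMFDerivWithinAt

/-- Coordinate lines in a plaque are integral curves; convexity of `s` makes their time domain an
interval. -/
theorem IsPlaqueOn.flowRel {G : EuclideanSpace ℝ (Fin 2) → M}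
    {s : Set (EuclideanSpace ℝ (Fin 2))} (hs : IsOpen s) (hc : Convex ℝ s)
    (hG : IsPlaqueOn Z G s) {a : EuclideanSpace ℝ (Fin 2)} (ha : a ∈ s) (i : Fin 2) {t : ℝ}
    (ht : a + t • EuclideanSpace.single i 1 ∈ s) :
    FlowRel Z (G a) (G (a + t • EuclideanSpace.single i 1)) := by
  have h1 := hG.isMIntegralCurveOn a (EuclideanSpace.single i 1)
  simp only [linComb_single] at h1
  refine ⟨i, _, _, ?_, ?_, h1, 0, by simpa using ha, t, ht, by simp, rfl⟩
  · exact hs.preimage (by fun_prop)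
  · refine Convex.ordConnected fun x hx y hy c d hc0 hd0 hcd ↦ ?_
    have := hc hx hy hc0 hd0 hcd
    rw [mem_ofPred_eq]
    convert this using 1
    obtain rfl : c = 1 - d := by linarith
    simp only [smul_eq_mul]
    module

theorem IsPlaqueOn.mem_reebOrbit {G : EuclideanSpace ℝ (Fin 2) → M} {r : ℝ} {p : M}
    (hG : IsPlaqueOn Z G (Metric.ball 0 r)) (h0 : G 0 ∈ reebOrbit Z p)
    {v : EuclideanSpace ℝ (Fin 2)} (hv : v ∈ Metric.ball 0 r) : G v ∈ reebOrbit Z p := by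
  have hr : 0 < r := Metric.pos_of_mem_ball hv
  -- The path to `v` follows `Z 0` and then `Z 1`; the corner `(v 0, 0)` stays in the ball because
  -- `|v 0| ≤ ‖v‖`.
  have e1 : (0 : EuclideanSpace ℝ (Fin 2)) + v 0 • EuclideanSpace.single 0 1 ∈
      Metric.ball (0 : EuclideanSpace ℝ (Fin 2)) r := by
    rw [mem_ball_zero_iff] at hv ⊢
    refine lt_of_le_of_lt ?_ hv
    rw [zero_add, norm_smul, PiLp.norm_single, norm_one, mul_one]
    exact PiLp.norm_apply_le v 0
  have e2 : (0 : EuclideanSpace ℝ (Fin 2)) + v 0 • EuclideanSpace.single 0 1 +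
      v 1 • EuclideanSpace.single 1 1 = v := by
    ext i
    fin_cases i <;> simp
  have h1 := hG.flowRel Metric.isOpen_ball (convex_ball _ _) (Metric.mem_ball_self hr) 0 e1
  have h2 := hG.flowRel Metric.isOpen_ball (convex_ball _ _) e1 1 (t := v 1) (by rwa [e2])
  rw [e2] at h2
  exact Relation.ReflTransGen.tail (Relation.ReflTransGen.tail h0 h1) h2

variable [IsManifold 𝓘(ℝ, E) ∞ M]

theorem smoothField_linComb (hZ : ∀ i, SmoothField (Z i)) (v : EuclideanSpace ℝ (Fin 2)) :
    SmoothField (fun x ↦ linComb Z x v) :=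
  ContMDiff.add_section (ContMDiff.smul_section (f := fun _ ↦ v 0) contMDiff_const (hZ 0))
    (ContMDiff.smul_section (f := fun _ ↦ v 1) contMDiff_const (hZ 1))

/-- Along each ray both maps are integral curves of the same smooth field `linComb Z · v`, so
uniqueness for ODEs applies. -/
theorem IsPlaqueOn.eqOn_ball [T2Space M] (hZ : ∀ i, SmoothField (Z i))
    {G G' : EuclideanSpace ℝ (Fin 2) → M} {r : ℝ} (hG : IsPlaqueOn Z G (Metric.ball 0 r))
    (hG' : IsPlaqueOn Z G' (Metric.ball 0 r)) (h0 : G 0 = G' 0) :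
    EqOn G G' (Metric.ball 0 r) := by
  have : IsManifold 𝓘(ℝ, E) 1 M := IsManifold.of_le (n := ∞) (by simp)
  intro v hv
  rcases eq_or_ne v 0 with rfl | hv0
  · exact h0
  have hn : 0 < ‖v‖ := norm_pos_iff.2 hv0
  rw [mem_ball_zero_iff] at hv
  have hsub : Ioo (-(r / ‖v‖)) (r / ‖v‖) ⊆ {t : ℝ | 0 + t • v ∈ Metric.ball 0 r} := by
    intro t ht
    rw [mem_ofPred_eq, zero_add, mem_ball_zero_iff, norm_smul, Real.norm_eq_abs]
    exact (lt_div_iff₀ hn).1 (abs_lt.2 ht)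
  have h1 : 1 < r / ‖v‖ := (one_lt_div hn).2 hv
  have h := isMIntegralCurveOn_Ioo_eqOn_of_contMDiff_boundaryless (t₀ := (0 : ℝ))
    ⟨by linarith, by linarith⟩ ((smoothField_linComb hZ v).of_le (by simp))
    ((hG.isMIntegralCurveOn 0 v).mono hsub) ((hG'.isMIntegralCurveOn 0 v).mono hsub)
    (by simpa using h0) (show (1 : ℝ) ∈ _ from ⟨by linarith, h1⟩)
  simpa using h

/-- Local injectivity at a point where the derivative is injective. -/
theorem exists_injOn_ball_of_injective [FiniteDimensional ℝ E]
    {F : EuclideanSpace ℝ (Fin 2) → E} {L : EuclideanSpace ℝ (Fin 2) →L[ℝ] E}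
    (hF : HasStrictFDerivAt F L 0) (hL : Function.Injective L) :
    ∃ r > 0, InjOn F (Metric.ball 0 r) := by
  -- Composing with a left inverse `K` of `L` gives derivative the identity, so the inverse function
  -- theorem makes `K ∘ F`, hence `F`, injective near `0`.
  obtain ⟨K, hK⟩ := LinearMap.exists_leftInverse_of_injective (L : EuclideanSpace ℝ (Fin 2) →ₗ[ℝ] E)
    (LinearMap.ker_eq_bot.2 hL)
  have h1 : HasStrictFDerivAt (LinearMap.toContinuousLinearMap K ∘ F)
      ((ContinuousLinearEquiv.refl ℝ (EuclideanSpace ℝ (Fin 2)) :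
        EuclideanSpace ℝ (Fin 2) →L[ℝ] EuclideanSpace ℝ (Fin 2))) 0 := by
    have e : (LinearMap.toContinuousLinearMap K).comp L =
        ContinuousLinearEquiv.refl ℝ (EuclideanSpace ℝ (Fin 2)) := by
      ext1 v
      exact congr($hK v)
    exact e ▸ (LinearMap.toContinuousLinearMap K).hasStrictFDerivAt.comp 0 hF
  obtain ⟨r, hr, hsub⟩ := Metric.isOpen_iff.1 (h1.toOpenPartialHomeomorph _).open_source 0
    h1.mem_toOpenPartialHomeomorph_source
  refine ⟨r, hr, fun a ha b hb hab ↦ ?_⟩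
  exact (h1.toOpenPartialHomeomorph _).injOn (hsub ha) (hsub hb)
    (congrArg (LinearMap.toContinuousLinearMap K) hab)

theorem exists_isPlaqueOn [FiniteDimensional ℝ E] (hZ : ∀ i, SmoothField (Z i))
    (hcomm : ∀ x, VectorField.mlieBracket 𝓘(ℝ, E) (Z 0) (Z 1) x = 0)
    (hind : ∀ x, Function.Injective (linComb Z x)) (q : M) :
    ∃ r > 0, ∃ G : EuclideanSpace ℝ (Fin 2) → M, G 0 = q ∧ IsPlaqueOn Z G (Metric.ball 0 r) ∧
      ContMDiffOn 𝓘(ℝ, EuclideanSpace ℝ (Fin 2)) 𝓘(ℝ, E) ∞ G (Metric.ball 0 r) ∧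
      InjOn G (Metric.ball 0 r) := by
  have : CompleteSpace E := FiniteDimensional.complete ℝ E
  set χ := extChartAt 𝓘(ℝ, E) q with hχ
  set A : E → EuclideanSpace ℝ (Fin 2) →L[ℝ] E := fun y ↦
    (EuclideanSpace.proj (𝕜 := ℝ) (0 : Fin 2)).smulRight (chartField q (Z 0) y) +
    (EuclideanSpace.proj (𝕜 := ℝ) (1 : Fin 2)).smulRight (chartField q (Z 1) y) with hA
  have hcf : ∀ i, ∀ y ∈ χ.target, ContDiffAt ℝ ∞ (chartField q (Z i)) y :=
    fun i y hy ↦ contDiffAt_chartField hy (hZ i _)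
  have hAs : ContDiffOn ℝ ∞ A χ.target := fun y hy ↦
    ((contDiffAt_const.smulRight (hcf 0 y hy)).add
      (contDiffAt_const.smulRight (hcf 1 y hy))).contDiffWithinAt
  have hAd : ∀ y ∈ χ.target, ∀ u w, fderiv ℝ A y u w =
      w 0 • fderiv ℝ (chartField q (Z 0)) y u + w 1 • fderiv ℝ (chartField q (Z 1)) y u := by
    intro y hy u w
    have hd := fun i ↦ ((hcf i y hy).differentiableAt (by simp)).hasFDerivAt
    have h1 : HasFDerivAt (fun y ↦ A y w) (w 0 • fderiv ℝ (chartField q (Z 0)) y +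
        w 1 • fderiv ℝ (chartField q (Z 1)) y) y :=
      ((hd 0).const_smul (w 0)).add ((hd 1).const_smul (w 1))
    have h2 := (hAs.contDiffAt (extChartAt_target_mem_nhds_of_mem hy)).differentiableAt (by simp)
    have h3 := congr($((h2.hasFDerivAt.clm_apply (hasFDerivAt_const w y)).unique h1) u)
    simpa using h3
  -- The antisymmetric part of `DA(A v) w` in `v, w` is a multiple of the bracket of the two fields
  -- in the chart, which is zero.
  have hcommA : ∀ y ∈ χ.target, ∀ v w, fderiv ℝ A y (A y v) w = fderiv ℝ A y (A y w) v := by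
    intro y hy v w
    have hl := chartField_mlieBracket hy (hZ 0) (hZ 1)
    have hl0 : chartField q (VectorField.mlieBracket 𝓘(ℝ, E) (Z 0) (Z 1)) y = 0 := by
      refine (congrArg _ (hcomm _)).trans ?_
      exact map_zero (mfderiv 𝓘(ℝ, E) 𝓘(ℝ, E) χ.symm y).inverse
    rw [hl0, VectorField.lieBracket, eq_comm, sub_eq_zero] at hl
    have hAy : ∀ u, A y u = u 0 • chartField q (Z 0) y + u 1 • chartField q (Z 1) y :=
      fun u ↦ rfl
    rw [hAd y hy, hAd y hy, hAy, hAy, map_add, map_add, map_add, map_add]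
    simp only [map_smul]
    rw [hl]
    module
  obtain ⟨r, hr, F, hF0, hF⟩ := exists_hasFDerivAt_of_commute (isOpen_extChartAt_target q)
    (hAs.of_le (by simpa using ENat.LEInfty.out)) hcommA (mem_extChartAt_target (I := 𝓘(ℝ, E)) q)
  have hFs := contDiffOn_of_hasFDerivAt hAs Metric.isOpen_ball hF
  have hlin : ∀ y ∈ χ.target, (mfderiv 𝓘(ℝ, E) 𝓘(ℝ, E) χ.symm y).comp (A y) =
      linComb Z (χ.symm y) := by
    intro y hy
    ext v
    refine (map_add (mfderiv 𝓘(ℝ, E) 𝓘(ℝ, E) χ.symm y) _ _).trans ?_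
    refine congrArg₂ (· + ·) ((map_smul (mfderiv 𝓘(ℝ, E) 𝓘(ℝ, E) χ.symm y) (v 0) _).trans ?_)
      ((map_smul (mfderiv 𝓘(ℝ, E) 𝓘(ℝ, E) χ.symm y) (v 1) _).trans ?_)
    · exact congrArg (v 0 • ·) (mfderiv_extChartAt_symm_apply_chartField (Z 0) hy)
    · exact congrArg (v 1 • ·) (mfderiv_extChartAt_symm_apply_chartField (Z 1) hy)
  have h0r : (0 : EuclideanSpace ℝ (Fin 2)) ∈ Metric.ball (0 : EuclideanSpace ℝ (Fin 2)) r :=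
    Metric.mem_ball_self hr
  obtain ⟨r', hr', hinj⟩ : ∃ r' > 0, InjOn F (Metric.ball 0 r') := by
    refine exists_injOn_ball_of_injective (((hFs.contDiffAt
      (Metric.isOpen_ball.mem_nhds h0r)).hasStrictFDerivAt' (hF 0 h0r).2 (by simp))) ?_
    have := hind (χ.symm (F 0))
    rw [← hlin _ (hF 0 h0r).1] at this
    exact Function.Injective.of_comp this
  have hball : Metric.ball (0 : EuclideanSpace ℝ (Fin 2)) (min r r') ⊆ Metric.ball 0 r :=
    Metric.ball_subset_ball (min_le_left _ _)
  refine ⟨min r r', lt_min hr hr', χ.symm ∘ F, by simp [hF0, hχ], ?_, ?_, ?_⟩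
  · intro v hv
    have hv' := hF v (hball hv)
    have h1 := ((contMDiffAt_extChartAt_symm hv'.1).mdifferentiableAt (by simp)).hasMFDerivAt.comp v
      (hasMFDerivAt_iff_hasFDerivAt.2 hv'.2)
    exact hlin _ hv'.1 ▸ h1
  · intro v hv
    have hv' := hF v (hball hv)
    exact ((contMDiffAt_extChartAt_symm hv'.1).comp v (contMDiffAt_iff_contDiffAt.2
      (hFs.contDiffAt (Metric.isOpen_ball.mem_nhds (hball hv))))).contMDiffWithinAt
  · intro a ha b hb hab
    exact hinj (Metric.ball_subset_ball (min_le_right _ _) ha)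
      (Metric.ball_subset_ball (min_le_right _ _) hb)
      (χ.symm.injOn (hF a (hball ha)).1 (hF b (hball hb)).1 hab)

end Plaques

/-! ### Orbits as immersed surfaces -/

section Leaves

variable {E : Type*} [NormedAddCommGroup E] [NormedSpace ℝ E]
  {M : Type*} [TopologicalSpace M] [ChartedSpace E M] [IsManifold 𝓘(ℝ, E) ∞ M]
  {Z : Fin 2 → Π x : M, TangentSpace 𝓘(ℝ, E) x}

/-- An injective local orbit map around every point. -/
structure PlaqueFamily (Z : Fin 2 → Π x : M, TangentSpace 𝓘(ℝ, E) x) where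
  smoothField : ∀ i, SmoothField (Z i)
  radius : M → ℝ
  radius_pos : ∀ q, 0 < radius q
  map : M → EuclideanSpace ℝ (Fin 2) → M
  map_zero : ∀ q, map q 0 = q
  isPlaqueOn : ∀ q, IsPlaqueOn Z (map q) (Metric.ball 0 (radius q))
  contMDiffOn : ∀ q, ContMDiffOn 𝓘(ℝ, EuclideanSpace ℝ (Fin 2)) 𝓘(ℝ, E) ∞ (map q)
    (Metric.ball 0 (radius q))
  injOn : ∀ q, InjOn (map q) (Metric.ball 0 (radius q))

theorem nonempty_plaqueFamily [FiniteDimensional ℝ E] (hZ : ∀ i, SmoothField (Z i))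
    (hcomm : ∀ x, VectorField.mlieBracket 𝓘(ℝ, E) (Z 0) (Z 1) x = 0)
    (hind : ∀ x, Function.Injective (linComb Z x)) : Nonempty (PlaqueFamily Z) := by
  choose r hr G h0 hG hs hinj using exists_isPlaqueOn hZ hcomm hind
  exact ⟨⟨hZ, r, hr, G, h0, hG, hs, hinj⟩⟩

namespace PlaqueFamily

/-- The orbit of `p`, to be equipped with the leaf topology. -/
@[ext]
structure Leaf (_P : PlaqueFamily Z) (p : M) where
  point : M
  mem : point ∈ reebOrbit Z p

variable (P : PlaqueFamily Z) (p : M)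

/-- The inclusion of a leaf. -/
def incl (x : P.Leaf p) : M :=
  x.point

theorem injective_incl : Function.Injective (P.incl p) :=
  fun _ _ h ↦ Leaf.ext h

theorem range_incl : range (P.incl p) = reebOrbit Z p :=
  Subset.antisymm (range_subset_iff.2 fun x ↦ x.mem) fun x hx ↦ ⟨⟨x, hx⟩, rfl⟩

instance : Nonempty (P.Leaf p) :=
  ⟨⟨p, Relation.ReflTransGen.refl⟩⟩

variable {p}

open Classical in
/-- The orbit map around `q`, as a map into the leaf. -/
def lift (q : P.Leaf p) (v : EuclideanSpace ℝ (Fin 2)) : P.Leaf p :=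
  if h : P.map (P.incl p q) v ∈ reebOrbit Z p then ⟨_, h⟩ else q

theorem incl_lift (q : P.Leaf p) {v : EuclideanSpace ℝ (Fin 2)}
    (hv : v ∈ Metric.ball 0 (P.radius (P.incl p q))) :
    P.incl p (P.lift q v) = P.map (P.incl p q) v := by
  have h : P.map (P.incl p q) v ∈ reebOrbit Z p :=
    (P.isPlaqueOn _).mem_reebOrbit (by rw [P.map_zero]; exact q.mem) hv
  rw [lift, dif_pos h]
  rfl

theorem injOn_lift (q : P.Leaf p) :
    InjOn (P.lift q) (Metric.ball 0 (P.radius (P.incl p q))) := by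
  intro a ha b hb hab
  refine P.injOn _ ha hb ?_
  rw [← P.incl_lift q ha, ← P.incl_lift q hb, hab]

/-- The inverse of the orbit map around `q`. -/
def chart (q : P.Leaf p) : PartialEquiv (P.Leaf p) (EuclideanSpace ℝ (Fin 2)) :=
  ((P.injOn_lift q).toPartialEquiv).symm

theorem chart_lift (q : P.Leaf p) {v : EuclideanSpace ℝ (Fin 2)}
    (hv : v ∈ Metric.ball 0 (P.radius (P.incl p q))) : P.chart q (P.lift q v) = v :=
  (P.chart q).right_inv hv

theorem zero_mem_ball (q : M) : (0 : EuclideanSpace ℝ (Fin 2)) ∈ Metric.ball 0 (P.radius q) :=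
  Metric.mem_ball_self (P.radius_pos q)

theorem lift_zero (q : P.Leaf p) : P.lift q 0 = q :=
  P.injective_incl p (by rw [P.incl_lift q (P.zero_mem_ball _), P.map_zero])

theorem chart_self (q : P.Leaf p) : P.chart q q = 0 := by
  have := P.chart_lift q (P.zero_mem_ball _)
  rwa [P.lift_zero] at this

theorem mem_chart_source (q : P.Leaf p) : q ∈ (P.chart q).source :=
  ⟨0, P.zero_mem_ball _, P.lift_zero q⟩

theorem incl_eq_map_chart (q : P.Leaf p) {x : P.Leaf p} (hx : x ∈ (P.chart q).source) :
    P.incl p x = P.map (P.incl p q) (P.chart q x) := by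
  obtain ⟨v, hv, rfl⟩ := hx
  rw [P.chart_lift q hv, P.incl_lift q hv]

/-- Changes of charts are locally translations. -/
theorem eventually_chart_transition [T2Space M] (q q' : P.Leaf p) {a : EuclideanSpace ℝ (Fin 2)}
    (ha : a ∈ ((P.chart q).symm.trans (P.chart q')).source) :
    ∀ᶠ v in 𝓝 a, v ∈ ((P.chart q).symm.trans (P.chart q')).source ∧
      ((P.chart q).symm.trans (P.chart q')) v =
        v + (((P.chart q).symm.trans (P.chart q')) a - a) := by
  obtain ⟨ha1, b, hb, hab⟩ := ha
  replace hab : P.lift q' b = P.lift q a := hab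
  replace ha1 : a ∈ Metric.ball 0 (P.radius (P.incl p q)) := ha1
  obtain ⟨δ₁, hδ₁, h1⟩ := Metric.isOpen_iff.1 Metric.isOpen_ball a ha1
  obtain ⟨δ₂, hδ₂, h2⟩ := Metric.isOpen_iff.1 Metric.isOpen_ball b hb
  set δ := min δ₁ δ₂ with hδ
  have e1 : ∀ v ∈ Metric.ball (0 : EuclideanSpace ℝ (Fin 2)) δ,
      a + v ∈ Metric.ball 0 (P.radius (P.incl p q)) := fun v hv ↦ h1 (by
    rw [mem_ball_zero_iff] at hv
    rw [mem_ball_iff_norm, add_sub_cancel_left]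
    exact hv.trans_le (min_le_left _ _))
  have e2 : ∀ v ∈ Metric.ball (0 : EuclideanSpace ℝ (Fin 2)) δ,
      b + v ∈ Metric.ball 0 (P.radius (P.incl p q')) := fun v hv ↦ h2 (by
    rw [mem_ball_zero_iff] at hv
    rw [mem_ball_iff_norm, add_sub_cancel_left]
    exact hv.trans_le (min_le_right _ _))
  have hT : ∀ v, ((P.chart q).symm.trans (P.chart q')) v = P.chart q' (P.lift q v) := fun v ↦ rfl
  -- Translates of plaques are plaques, and these two agree at `0`. Uniqueness therefore makes the
  -- transition map `a + v ↦ b + v`.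
  have heq : EqOn (fun v ↦ P.map (P.incl p q) (a + v)) (fun v ↦ P.map (P.incl p q') (b + v))
      (Metric.ball 0 δ) := by
    refine IsPlaqueOn.eqOn_ball P.smoothField
      (fun v hv ↦ (P.isPlaqueOn _).comp_const_add a v (e1 v hv))
      (fun v hv ↦ (P.isPlaqueOn _).comp_const_add b v (e2 v hv)) ?_
    simp only [add_zero]
    rw [← P.incl_lift q ha1, ← P.incl_lift q' hb, hab]
  filter_upwards [Metric.ball_mem_nhds a (lt_min hδ₁ hδ₂)] with v hv
  have hv' : v - a ∈ Metric.ball (0 : EuclideanSpace ℝ (Fin 2)) δ := by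
    rwa [mem_ball_zero_iff, ← mem_ball_iff_norm]
  have hv1 := e1 _ hv'
  have hv2 := e2 _ hv'
  have hl : P.lift q' (b + (v - a)) = P.lift q v := by
    apply P.injective_incl p
    have := heq hv'
    rw [add_sub_cancel] at hv1
    simp only [add_sub_cancel] at this
    rw [P.incl_lift q' hv2, P.incl_lift q hv1, this]
  refine ⟨⟨by rwa [add_sub_cancel] at hv1, _, hv2, hl⟩, ?_⟩
  rw [hT, hT, ← hl, ← hab, P.chart_lift q' hv2, P.chart_lift q' hb]
  abel

variable [T2Space M]

variable (p) in
/-- The atlas of the leaf through `p`. -/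
def core : ChartedSpaceCore (EuclideanSpace ℝ (Fin 2)) (P.Leaf p) where
  atlas := range P.chart
  chartAt := P.chart
  mem_chart_source := P.mem_chart_source
  chart_mem_atlas := mem_range_self
  open_source := by
    rintro _ _ ⟨q, rfl⟩ ⟨q', rfl⟩
    exact isOpen_iff_mem_nhds.2 fun a ha ↦
      (P.eventually_chart_transition q q' ha).mono fun _ h ↦ h.1
  continuousOn_toFun := by
    rintro _ _ ⟨q, rfl⟩ ⟨q', rfl⟩ a ha
    refine ContinuousAt.continuousWithinAt (ContinuousAt.congr (f := fun v ↦
      v + (((P.chart q).symm.trans (P.chart q')) a - a)) (by fun_prop) ?_)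
    exact (P.eventually_chart_transition q q' ha).mono fun _ h ↦ h.2.symm

instance : TopologicalSpace (P.Leaf p) :=
  (P.core p).toTopologicalSpace

instance : ChartedSpace (EuclideanSpace ℝ (Fin 2)) (P.Leaf p) :=
  (P.core p).toChartedSpace

instance : IsManifold (𝓡 2) ∞ (P.Leaf p) := by
  refine isManifold_of_contDiffOn _ _ _ fun e e' he he' ↦ ?_
  obtain ⟨_, ⟨q, rfl⟩, rfl⟩ := mem_iUnion₂.1 he
  obtain ⟨_, ⟨q', rfl⟩, rfl⟩ := mem_iUnion₂.1 he'
  rintro a ⟨ha, -⟩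
  have h := P.eventually_chart_transition q q' (a := a) ha
  refine (ContDiffAt.congr_of_eventuallyEq (f := fun v ↦
    v + (((P.chart q).symm.trans (P.chart q')) a - a)) (by fun_prop) ?_).contDiffWithinAt
  exact h.mono fun _ h ↦ h.2

/-- Near `q` the inclusion is the orbit map composed with the preferred chart at `q`, whose
derivative there is the identity. -/
theorem hasMFDerivAt_incl (q : P.Leaf p) :
    HasMFDerivAt (𝓡 2) 𝓘(ℝ, E) (P.incl p) q (linComb Z (P.incl p q)) ∧
      ContMDiffAt (𝓡 2) 𝓘(ℝ, E) ∞ (P.incl p) q := by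
  have : IsManifold (𝓡 2) 1 (P.Leaf p) := IsManifold.of_le (n := ∞) (by simp)
  have h0 : extChartAt (𝓡 2) q q = 0 := P.chart_self q
  have he : P.incl p =ᶠ[𝓝 q] P.map (P.incl p q) ∘ extChartAt (𝓡 2) q := by
    filter_upwards [extChartAt_source_mem_nhds (I := 𝓡 2) q] with x hx
    rw [extChartAt_source] at hx
    exact P.incl_eq_map_chart q hx
  constructor
  · have h1 := P.isPlaqueOn (P.incl p q) 0 (P.zero_mem_ball _)
    rw [← h0] at h1
    have h2 := h1.comp q (mdifferentiableAt_extChartAt (_root_.mem_chart_source _ q)).hasMFDerivAt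
    rw [mfderiv_extChartAt_self, h0, P.map_zero] at h2
    exact h2.congr_of_eventuallyEq he
  · have h1 := (P.contMDiffOn (P.incl p q)).contMDiffAt
      (Metric.isOpen_ball.mem_nhds (P.zero_mem_ball _))
    rw [← h0] at h1
    exact (h1.comp q contMDiffAt_extChartAt).congr_of_eventuallyEq he

instance : T2Space (P.Leaf p) :=
  .of_injective_continuous (P.injective_incl p)
    (continuous_iff_continuousAt.2 fun q ↦ (P.hasMFDerivAt_incl q).2.continuousAt)

end PlaqueFamily

end Leaves

/-! ### Reeb orbits as totally geodesic surfaces -/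

section TotallyGeodesic

universe u

variable {E : Type*} [NormedAddCommGroup E] [NormedSpace ℝ E]
  {M : Type u} [TopologicalSpace M] [ChartedSpace E M] [IsManifold 𝓘(ℝ, E) ∞ M]
  {α : Fin 2 → Π x : M, TangentSpace 𝓘(ℝ, E) x →L[ℝ] ℝ}
  {Z : Fin 2 → Π x : M, TangentSpace 𝓘(ℝ, E) x}

theorem SmoothOneForm.mdifferentiableAt_apply {β : Π x : M, TangentSpace 𝓘(ℝ, E) x →L[ℝ] ℝ}
    (hβ : SmoothOneForm β) {X : Π x : M, TangentSpace 𝓘(ℝ, E) x} {x : M}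
    (hX : MDifferentiableAt 𝓘(ℝ, E) (𝓘(ℝ, E).prod 𝓘(ℝ, E))
      (fun x ↦ (TotalSpace.mk' E x (X x) : TangentBundle 𝓘(ℝ, E) M)) x) :
    MDifferentiableAt 𝓘(ℝ, E) 𝓘(ℝ, ℝ) (fun x ↦ β x (X x)) x := by
  have h := MDifferentiableAt.clm_bundle_apply (E₂ := Bundle.Trivial M ℝ) (b := id)
    ((hβ x).mdifferentiableAt (by simp)) hX
  simpa using (mdifferentiableAt_section _ _).1 h

theorem IsReebPair.apply_linComb (hR : IsReebPair α Z) (i : Fin 2) (x : M)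
    (v : EuclideanSpace ℝ (Fin 2)) : α i x (linComb Z x v) = v i := by
  rw [linComb_apply, map_add, map_smul, map_smul, hR.apply_eq, hR.apply_eq]
  fin_cases i <;> simp

theorem IsReebPair.injective_linComb (hR : IsReebPair α Z) (x : M) :
    Function.Injective (linComb Z x) := by
  intro v w hvw
  ext i
  rw [← hR.apply_linComb i x v, hvw, hR.apply_linComb]

theorem IsReebPair.isTotallyGeodesic [FiniteDimensional ℝ E] (hR : IsReebPair α Z)
    (hα : ∀ i, SmoothOneForm (α i)) {cov : Connection E M}
    (hcov : ∀ i j x, cov (Z j) x (Z i x) = 0) {N : Type u} [TopologicalSpace N]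
    [ChartedSpace (EuclideanSpace ℝ (Fin 2)) N] {f : N → M}
    (hf : ∀ q, HasMFDerivAt (𝓡 2) 𝓘(ℝ, E) f q (linComb Z (f q))) : IsTotallyGeodesic cov f := by
  have : IsManifold 𝓘(ℝ, E) 1 M := IsManifold.of_le (n := ∞) (by simp)
  have hcZ : ∀ x (v : EuclideanSpace ℝ (Fin 2)) j, cov (Z j) x (linComb Z x v) = 0 := fun x v j ↦ by
    rw [linComb_apply, map_add, map_smul, map_smul, hcov, hcov, smul_zero, smul_zero, add_zero]
  have hproj : ∀ x (v : EuclideanSpace ℝ (Fin 2)), linComb Z x v =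
      α 0 x (linComb Z x v) • Z 0 x + α 1 x (linComb Z x v) • Z 1 x := fun x v ↦ by
    rw [hR.apply_linComb, hR.apply_linComb, linComb_apply]
  intro q Y hY htan w
  simp only [(hf _).mfderiv] at htan ⊢
  have hc := fun i ↦ (hα i).mdifferentiableAt_apply hY
  have hZ := fun i ↦ (hR.smooth i).mdifferentiableAt (f q)
  have hT0 := MDifferentiableAt.smul_section (hc 0) (hZ 0)
  have hT1 := MDifferentiableAt.smul_section (hc 1) (hZ 1)
  have hTd := mdifferentiableAt_add_section hT0 hT1
  have hWd := mdifferentiableAt_sub_section hY hTd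
  -- Along `f` the tangent field `Y` equals `Σ α_i(Y) Z_i`, so the difference of the two vanishes
  -- along `f`.
  have hW := cov.apply_mfderiv_eq_zero (hf q).mdifferentiableAt hWd (by
    filter_upwards [htan] with q' ⟨v, hv⟩
    refine sub_eq_zero.2 ?_
    change _ = α 0 _ (Y (f q')) • Z 0 (f q') + α 1 _ (Y (f q')) • Z 1 (f q')
    rw [← hv]
    exact hproj _ _) w
  have hu := hcZ (f q) w
  rw [(hf q).mfderiv] at hW
  suffices H : ∀ u : TangentSpace 𝓘(ℝ, E) (f q), cov (Y - ((fun x ↦ α 0 x (Y x)) • Z 0 +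
      (fun x ↦ α 1 x (Y x)) • Z 1)) (f q) u = 0 → (∀ j, cov (Z j) (f q) u = 0) →
      cov Y (f q) u ∈ range (linComb Z (f q)) from H _ hW hu
  intro u hW hu
  -- In the Leibniz rule for `Σ α_i(Y) Z_i` the terms `∇_u Z_i` vanish, leaving the derivatives of
  -- the coefficients.
  refine ⟨!₂[mvfderiv 𝓘(ℝ, E) (fun x ↦ α 0 x (Y x)) (f q) u,
    mvfderiv 𝓘(ℝ, E) (fun x ↦ α 1 x (Y x)) (f q) u], ?_⟩
  have hC := cov.isCovariantDerivativeOnUniv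
  have key := congr($(hC.add hWd hTd) u)
  rw [sub_add_cancel, add_apply, hW, zero_add, hC.add hT0 hT1, hC.leibniz (hZ 0) (hc 0),
    hC.leibniz (hZ 1) (hc 1)] at key
  simp only [add_apply, smul_apply, hu, smul_zero, zero_add] at key
  exact key.symm

theorem IsLeviCivita.isTotallyGeodesicSurface_reebOrbit [FiniteDimensional ℝ E] [T2Space M]
    {h k : ℕ} {φ : Π x : M, TangentSpace 𝓘(ℝ, E) x →L[ℝ] TangentSpace 𝓘(ℝ, E) x}
    {g : Metric E M} (hS : IsContactPairStructure h k α Z φ) (hg : IsCompatible α φ g)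
    {cov : Connection E M} (hc : IsLeviCivita g cov) (p : M) :
    IsTotallyGeodesicSurface cov (reebOrbit Z p) := by
  obtain ⟨P⟩ := nonempty_plaqueFamily hS.reeb.smooth
    (hS.reeb.mlieBracket_eq_zero hS.contactPair 0 1) hS.reeb.injective_linComb
  refine ⟨P.Leaf p, inferInstance, inferInstance, inferInstance, inferInstance, P.incl p,
    fun q ↦ (P.hasMFDerivAt_incl q).2, fun q ↦ ?_, P.injective_incl p, P.range_incl p,
    hS.reeb.isTotallyGeodesic hS.smoothOneForm (hc.cov_reeb hS hg)
      fun q ↦ (P.hasMFDerivAt_incl q).1⟩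
  rw [(P.hasMFDerivAt_incl q).1.mfderiv]
  exact hS.reeb.injective_linComb _

end TotallyGeodesic

end ContactPair

end

/-! ### The main theorem -/

theorem mainTheorem1
    {E : Type*} [NormedAddCommGroup E] [NormedSpace ℝ E] [FiniteDimensional ℝ E]
    {M : Type*} [TopologicalSpace M] [ChartedSpace E M] [IsManifold 𝓘(ℝ, E) ∞ M] [T2Space M]
    (h k : ℕ)
    (α : Fin 2 → Π x : M, TangentSpace 𝓘(ℝ, E) x →L[ℝ] ℝ)
    (Z : Fin 2 → Π x : M, TangentSpace 𝓘(ℝ, E) x)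
    (φ : Π x : M, TangentSpace 𝓘(ℝ, E) x →L[ℝ] TangentSpace 𝓘(ℝ, E) x)
    (hS : ContactPair.IsContactPairStructure h k α Z φ)
    (g : ContactPair.Metric E M) (hg : ContactPair.IsCompatible α φ g) :
    (∀ i (x : M) (w : TangentSpace 𝓘(ℝ, E) x), g.inner x (Z i x) w = α i x w) ∧
    (∀ i j (x : M), g.inner x (Z i x) (Z j x) = if i = j then 1 else 0) ∧
    (∀ cov : ContactPair.Connection E M, ContactPair.IsLeviCivita g cov →
      (∀ i j (x : M), cov (Z j) x (Z i x) = 0) ∧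
      (∀ i (γ : ℝ → M) (s : Set ℝ), IsOpen s → s.OrdConnected →
        IsMIntegralCurveOn γ (Z i) s → ContactPair.IsGeodesicOn cov γ s) ∧
      (∀ p : M, ContactPair.IsTotallyGeodesicSurface cov (ContactPair.reebOrbit Z p))) ∧
    (ContactPair.IsAssociated α Z φ g →
      ∀ i, ContactPair.LieDerivEndoVanishes (Z i) φ ↔ ContactPair.IsKilling g (Z i)) := by
  refine ⟨fun i x w ↦ hg.inner_reeb hS i x w, fun i j x ↦ hg.inner_reeb_reeb hS i j x,
    fun cov hc ↦ ⟨fun i j x ↦ hc.cov_reeb hS hg i j x, fun i γ s hs _ hγ ↦ ?_,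
      fun p ↦ hc.isTotallyGeodesicSurface_reebOrbit hS hg p⟩,
    fun ha i ↦ ha.lieDerivEndoVanishes_iff hS hg i⟩
  have : CompleteSpace E := FiniteDimensional.complete ℝ E
  refine ⟨ContactPair.contMDiffOn_of_isMIntegralCurveOn (hS.reeb.smooth i) hs hγ, fun t ht ↦ ?_⟩
  rw [ContactPair.covDerivAlong_velocity cov (hS.reeb.smooth i) hs hγ ht]
  exact hc.cov_reeb hS hg i i (γ t)
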